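/- Let $(V,E,i,t)$ be a finite directed multigraph ($i(e)$, $t(e)$ the initial and terminal vertex of the edge $e$) with $i:E\to V$ surjective. Let $(K,d)$ be a metric space in which sets of finite diameter are relatively compact, and let $(K_v)_{v\in V}$ be a partition of $K$ into non-empty open sets. For $e\in E$ let $w_e:K\to K$ be Borel measurable with $w_e(K_{i(e)})\subset K_{t(e)}$, and let $p_e:K\to[0,1]$ be Borel measurable, zero outside $K_{i(e)}$, with $\sum_{e\in E}p_e(x)=1$ for all $x\in K$. Assume that for some $0<a<1$ $$\sum_{e\in E}p_e(x)\,d(w_ex,w_ey)\le a\,d(x,y)\qquad\text{for all }v\in V,\ x,y\in K_v,$$ that each $p_e|_{K_{i(e)}}$ is uniformly continuous, and that for some $\delta>0$ one has $p_e|_{K_{i(e)}}\ge\delta$ for all $e\in E$. Put $Uf:=\sum_{e\in E}p_e\cdot f\circ w_e$ for bounded Borel $f$ and $U^*\nu(f):=\int Uf\,d\nu$ for Borel probability measures $\nu$ on $K$, and assume that there is a Borel probability measure $\mu$ on $K$ with $U^*\mu=\mu$. Let $\Sigma:=E^{\mathbb Z}$ with the product topology and the left shift $S$, fix $x_v\in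 K_v$ for all $v\in V$, and set $$F(\sigma):=\lim_{m\to-\infty}w_{\sigma_0}\circ w_{\sigma_{-1}}\circ\dots\circ w_{\sigma_m}x_{i(\sigma_m)}$$ whenever the limit exists. Let $\Sigma_G:=\{\sigma\in\Sigma: t(\sigma_j)=i(\sigma_{j+1})\ \forall j\in\mathbb Z\}$, let $D$ be the set of all $\sigma\in\Sigma_G$ for which this limit exists, and let $Y:=\bigcap_{j\in\mathbb Z}S^j(D)$. Define $u:\Sigma\to[-\infty,0]$ by $u(\sigma):=\log p_{\sigma_1}(F(\sigma))$ for $\sigma\in Y$ and $u(\sigma):=-\infty$ for $\sigma\in\Sigma\setminus Y$. Let $P_S(\Sigma)$ be the set of $S$-invariant Borel probability measures on $\Sigma$ and $h_\Theta(S)$ the Kolmogorov–Sinai entropy of $S$ with respect to $\Theta$. If $\Lambda\in P_S(\Sigma)$ is an equilibrium state for $u$, i.e. $h_\Lambda(S)+\int u\,d\Lambda=\sup_{\Theta\in P_S(\Sigma)}\bigl(h_\Theta(S)+\int u\,d\Theta\bigr)$, then $\Lambda(Y)=1$ (so that $F$ is defined $\Lambda$-a.e.), $F$ is $\Lambda$-measurable,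 and its image measure $F(\Lambda)$ satisfies $$U^*F(\Lambda)=F(\Lambda).$$ -/

import Mathlib

open MeasureTheory Filter Topology Set

noncomputable section

/-! ### Kolmogorov-Sinai entropy, pressure, equilibrium states -/

/-- Shannon entropy (natural logarithm) of the finite partition of `X` into the fibres of a map
`ξ` with values in a finite type. -/
def partitionEntropy {X : Type*} [MeasurableSpace X] (μ : Measure X)
    {ι : Type*} [Fintype ι] (ξ : X → ι) : ℝ :=
  ∑ c : ι, Real.negMulLog (μ.real (ξ ⁻¹' {c}))

/-- The label map of the joined partition `⋁_{j < n} T⁻ʲ ξ`. -/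
def itinerary {X ι : Type*} (T : X → X) (ξ : X → ι) (n : ℕ) : X → (Fin n → ι) :=
  fun x j => ξ (T^[(j : ℕ)] x)

/-- The entropy `h_μ(T, ξ) = lim (1/n) H(⋁_{j < n} T⁻ʲ ξ)` of `T` with respect to a finite
partition.  For an invariant probability measure the limit exists, so the upper limit is the
limit. -/
def entropyOfPartition {X : Type*} [MeasurableSpace X] (T : X → X) (μ : Measure X)
    {ι : Type*} [Fintype ι] (ξ : X → ι) : EReal :=
  limsup (fun n : ℕ => ((partitionEntropy μ (itinerary T ξ n) / (n : ℝ) : ℝ) : EReal)) atTop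

/-- The Kolmogorov-Sinai entropy `h_μ(T)`: the supremum over all finite measurable partitions. -/
def ksEntropy {X : Type*} [MeasurableSpace X] (T : X → X) (μ : Measure X) : EReal :=
  ⨆ (k : ℕ) (ξ : X → Fin k) (_ : Measurable ξ), entropyOfPartition T μ ξ

/-- The set `P_T(X)` of `T`-invariant probability measures. -/
def invariantProb {X : Type*} [MeasurableSpace X] (T : X → X) : Set (Measure X) :=
  {μ | IsProbabilityMeasure μ ∧ MeasurePreserving T μ μ}

/-- The integral `μ(f) ∈ [-∞, 0]` of an energy function `f : X → [-∞, 0]`. -/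
def energyIntegral {X : Type*} [MeasurableSpace X] (μ : Measure X) (f : X → EReal) : EReal :=
  -((∫⁻ x, (-(f x)).toENNReal ∂μ : ENNReal) : EReal)

/-- The pressure of an energy function. -/
def pressure {X : Type*} [MeasurableSpace X] (T : X → X) (f : X → EReal) : EReal :=
  ⨆ μ ∈ invariantProb T, (ksEntropy T μ + energyIntegral μ f)

/-- Equilibrium states of an energy function. -/
def IsEquilibriumState {X : Type*} [MeasurableSpace X] (T : X → X) (f : X → EReal)
    (μ : Measure X) : Prop :=
  μ ∈ invariantProb T ∧ ksEntropy T μ + energyIntegral μ f = pressure T f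

/-! ### The code space -/

/-- The left shift on the code space `ℤ → E`. The code space carries the product σ-algebra,
which for a finite discrete `E` is the Borel σ-algebra of the product topology. -/
def codeShift (E : Type*) : Equiv.Perm (ℤ → E) where
  toFun σ := fun k => σ (k + 1)
  invFun σ := fun k => σ (k - 1)
  left_inv σ := by funext k; simp
  right_inv σ := by funext k; simp

/-! ### Markov systems -/

/-- A Markov system `(K_{i(e)}, w_e, p_e)_{e ∈ E}` on `K`, over the finite directed multigraph
with vertices `V`, edges `E`, initial vertices `ini` and terminal vertices `ter`. -/
structure MarkovSystem (V E K : Type*) [Fintype E] [MeasurableSpace K] where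
  ini : E → V
  ter : E → V
  vertexSet : V → Set K
  w : E → K → K
  p : E → K → ℝ
  vertexSet_measurable : ∀ v, MeasurableSet (vertexSet v)
  vertexSet_nonempty : ∀ v, (vertexSet v).Nonempty
  vertexSet_disjoint : ∀ v v', v ≠ v' → Disjoint (vertexSet v) (vertexSet v')
  vertexSet_cover : (⋃ v, vertexSet v) = univ
  w_measurable : ∀ e, Measurable (w e)
  w_mapsTo : ∀ e, MapsTo (w e) (vertexSet (ini e)) (vertexSet (ter e))
  p_measurable : ∀ e, Measurable (p e)
  p_nonneg : ∀ e x, 0 ≤ p e x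
  p_sum : ∀ x, ∑ e, p e x = 1
  p_zero : ∀ e x, x ∉ vertexSet (ini e) → p e x = 0

namespace MarkovSystem

variable {V E K : Type*} [Fintype E] [MeasurableSpace K]

/-- Contractiveness on average, with average contracting rate `a`. -/
def IsContractive [PseudoMetricSpace K] (𝓜 : MarkovSystem V E K) (a : ℝ) : Prop :=
  0 < a ∧ a < 1 ∧ ∀ v, ∀ x ∈ 𝓜.vertexSet v, ∀ y ∈ 𝓜.vertexSet v,
    ∑ e, 𝓜.p e x * dist (𝓜.w e x) (𝓜.w e y) ≤ a * dist x y

/-- The Markov operator `U f = ∑ e, p_e · (f ∘ w_e)`. -/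
def markovOp (𝓜 : MarkovSystem V E K) (f : K → ℝ) : K → ℝ :=
  fun x => ∑ e, 𝓜.p e x * f (𝓜.w e x)

/-- The adjoint operator `U*` on measures; see `integral_adjointOp` below. -/
def adjointOp (𝓜 : MarkovSystem V E K) (ν : Measure K) : Measure K :=
  ∑ e, (ν.withDensity (fun x => ENNReal.ofReal (𝓜.p e x))).map (𝓜.w e)

/-- `adjointOp` is the adjoint of the Markov operator: `U*ν(f) = ∫ U f dν` for bounded Borel
functions `f`. -/
theorem integral_adjointOp (𝓜 : MarkovSystem V E K) (ν : Measure K) [IsProbabilityMeasure ν]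
    (f : K → ℝ) (hf : Measurable f) (C : ℝ) (hC : ∀ x, |f x| ≤ C) :
    ∫ x, f x ∂(𝓜.adjointOp ν) = ∫ x, 𝓜.markovOp f x ∂ν := by
  have hp1 : ∀ e x, 𝓜.p e x ≤ 1 := fun e x => by
    rw [← 𝓜.p_sum x]
    exact Finset.single_le_sum (fun e _ => 𝓜.p_nonneg e x) (Finset.mem_univ e)
  have hm : ∀ e, Measurable fun x => Real.toNNReal (𝓜.p e x) :=
    fun e => (𝓜.p_measurable e).real_toNNReal
  have hfin : ∀ e, IsFiniteMeasure (ν.withDensity (fun x => ENNReal.ofReal (𝓜.p e x))) := by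
    intro e
    refine isFiniteMeasure_withDensity (ne_of_lt ?_)
    calc ∫⁻ x, ENNReal.ofReal (𝓜.p e x) ∂ν ≤ ∫⁻ _, 1 ∂ν :=
          lintegral_mono fun x => by simpa using hp1 e x
      _ < ⊤ := by simp
  have hint : ∀ e, Integrable f
      ((ν.withDensity (fun x => ENNReal.ofReal (𝓜.p e x))).map (𝓜.w e)) := by
    intro e
    have := hfin e
    exact Integrable.of_bound hf.aestronglyMeasurable C (ae_of_all _ hC)
  have hint2 : ∀ e, Integrable (fun x => 𝓜.p e x * f (𝓜.w e x)) ν := by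
    intro e
    refine Integrable.of_bound
      ((𝓜.p_measurable e).mul (hf.comp (𝓜.w_measurable e))).aestronglyMeasurable C
      (ae_of_all _ fun x => ?_)
    rw [norm_mul, Real.norm_of_nonneg (𝓜.p_nonneg e x), Real.norm_eq_abs]
    exact (mul_le_of_le_one_left (abs_nonneg _) (hp1 e x)).trans (hC _)
  unfold adjointOp markovOp
  rw [integral_finsetSum_measure (fun e _ => hint e), integral_finsetSum _ (fun e _ => hint2 e)]
  refine Finset.sum_congr rfl fun e _ => ?_
  rw [integral_map (𝓜.w_measurable e).aemeasurable hf.aestronglyMeasurable]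
  have := integral_withDensity_eq_integral_smul (μ := ν) (hm e) (fun x => f (𝓜.w e x))
  refine Eq.trans this (integral_congr_ae (ae_of_all _ fun x => ?_))
  simp [NNReal.smul_def, Real.coe_toNNReal _ (𝓜.p_nonneg e x)]

/-- The composition `w_{σ_0} ∘ w_{σ_{-1}} ∘ ⋯ ∘ w_{σ_{-n}}`. -/
def backComp (𝓜 : MarkovSystem V E K) (σ : ℤ → E) : ℕ → K → K
  | 0 => 𝓜.w (σ 0)
  | n + 1 => 𝓜.backComp σ n ∘ 𝓜.w (σ (-((n : ℤ) + 1)))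

/-- The approximant `w_{σ_0} ∘ ⋯ ∘ w_{σ_{-n}} x_{i(σ_{-n})}` of the coding map. -/
def codingApprox (𝓜 : MarkovSystem V E K) (x : V → K) (σ : ℤ → E) (n : ℕ) : K :=
  𝓜.backComp σ n (x (𝓜.ini (σ (-(n : ℤ)))))

/-- The set `Σ_G` of two-sided infinite paths of the graph. -/
def pathSpace (𝓜 : MarkovSystem V E K) : Set (ℤ → E) :=
  {σ | ∀ j : ℤ, 𝓜.ter (σ j) = 𝓜.ini (σ (j + 1))}

/-- The set `D` of paths for which the limit defining the coding map exists. -/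
def codingDomain [TopologicalSpace K] (𝓜 : MarkovSystem V E K) (x : V → K) : Set (ℤ → E) :=
  {σ | σ ∈ 𝓜.pathSpace ∧ ∃ z, Tendsto (𝓜.codingApprox x σ) atTop (𝓝 z)}

/-- The set `Y = ⋂_{j ∈ ℤ} S^j(D)`. -/
def codingCore [TopologicalSpace K] (𝓜 : MarkovSystem V E K) (x : V → K) : Set (ℤ → E) :=
  ⋂ j : ℤ, (codeShift E ^ j : Equiv.Perm (ℤ → E)) '' 𝓜.codingDomain x

open Classical in
/-- The coding map `F`, the limit of the approximants where it exists (and an irrelevant value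
elsewhere). -/
def codingMap [TopologicalSpace K] (𝓜 : MarkovSystem V E K) (x : V → K) (σ : ℤ → E) : K :=
  if h : ∃ z, Tendsto (𝓜.codingApprox x σ) atTop (𝓝 z) then h.choose else x (𝓜.ini (σ 0))

open Classical in
/-- The energy function `u`: `log p_{σ_1}(F(σ))` on `Y` and `-∞` off `Y`. -/
def energy [TopologicalSpace K] (𝓜 : MarkovSystem V E K) (x : V → K) (σ : ℤ → E) : EReal :=
  if σ ∈ 𝓜.codingCore x then
    ENNReal.log (ENNReal.ofReal (𝓜.p (σ 1) (𝓜.codingMap x σ)))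
  else ⊥

end MarkovSystem

end

/-!
Bi-infinite paths with weights `p` carry a stationary Markov measure built from `μ`. Under it
`(σ_1, F(σ))` has the law `p_e(y) μ(dy)`, so its entropy cancels the integral of the energy; hence
the pressure is nonnegative and an equilibrium state `Λ` cannot charge the set where `u = -∞`.
Conversely, `h_Λ(S)` is at most the mean logarithmic loss `∫ -log q_{σ_1}(F(σ)) dΛ` of predicting
`σ_1` from the past with any continuous conditional probabilities `q`, so nonnegativity of
`h_Λ(S) + ∫ u dΛ` says that `p` minimises this loss. Perturbing `p` to
`q_e = p_e (1 + t (f ∘ w_e - U f))`, the derivative in `t` of the loss must vanish at `t = 0`, which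
is `∫ (f ∘ w_{σ_1} - U f)(F(σ)) dΛ = 0`. Since `w_{σ_1} (F σ) = F (S σ)` and `Λ` is invariant, this
is `F(Λ)(f) = F(Λ)(U f)`.
-/

/-! ### Entropy of finite partitions and prediction -/

section FiniteValued

variable {X ι : Type*} [MeasurableSpace X] {μ : Measure X}

theorem ae_measureReal_preimage_singleton_pos [Countable ι] [IsFiniteMeasure μ] (Z : X → ι) :
    ∀ᵐ x ∂μ, 0 < μ.real (Z ⁻¹' {Z x}) := by
  have pos_of_eq : ∀ᵐ x ∂μ, ∀ c, Z x = c → 0 < μ.real (Z ⁻¹' {c}) := by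
    refine ae_all_iff.2 fun c => ?_
    by_cases h : μ.real (Z ⁻¹' {c}) = 0
    · rw [measureReal_eq_zero_iff] at h
      filter_upwards [measure_eq_zero_iff_ae_notMem.1 h] with x hx hc using absurd hc hx
    · exact ae_of_all _ fun x _ => measureReal_nonneg.lt_of_ne' h
  filter_upwards [pos_of_eq] with x hx using hx _ rfl

variable [Finite ι] [MeasurableSpace ι] [MeasurableSingletonClass ι] {Z : X → ι}

theorem measurable_of_factorsThrough {Y : Type*} [MeasurableSpace Y] (hZ : Measurable Z)
    {f : X → Y} (hf : f.FactorsThrough Z) : Measurable f := by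
  intro s _
  have preimage_eq : f ⁻¹' s = Z ⁻¹' (Z '' (f ⁻¹' s)) := by
    refine (subset_preimage_image _ _).antisymm ?_
    rintro x ⟨y, hy, hyx⟩
    rwa [mem_preimage, ← hf hyx]
  rw [preimage_eq]
  exact hZ (toFinite _).measurableSet

theorem integrable_of_factorsThrough [IsFiniteMeasure μ] (hZ : Measurable Z) {f : X → ℝ}
    (hf : f.FactorsThrough Z) : Integrable f μ := by
  have f_eq : f = Function.extend Z f 0 ∘ Z := funext fun x => (hf.extend_apply 0 x).symm
  rw [f_eq]
  exact (Integrable.of_finite (μ := μ.map Z)).comp_measurable hZ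

theorem integral_comp_eq_sum {ι : Type*} [Fintype ι] [MeasurableSpace ι]
    [MeasurableSingletonClass ι] [IsFiniteMeasure μ] {Z : X → ι} (hZ : Measurable Z) (φ : ι → ℝ) :
    ∫ x, φ (Z x) ∂μ = ∑ c, μ.real (Z ⁻¹' {c}) * φ c := by
  rw [← integral_map (f := φ) hZ.aemeasurable (measurable_of_finite φ).aestronglyMeasurable,
    integral_fintype Integrable.of_finite]
  simp only [map_measureReal_apply hZ (measurableSet_singleton _), smul_eq_mul]

theorem sum_measureReal_preimage_singleton_univ {ι : Type*} [Fintype ι] [MeasurableSpace ι]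
    [MeasurableSingletonClass ι] [IsProbabilityMeasure μ] {Z : X → ι} (hZ : Measurable Z) :
    ∑ c, μ.real (Z ⁻¹' {c}) = 1 := by
  simpa using (integral_comp_eq_sum (μ := μ) hZ fun _ => (1 : ℝ)).symm

end FiniteValued

/-- A predictor of a `κ`-valued variable given `Z`: a subprobability vector on `κ` which is a
function of `Z`. It is indexed by the points of the sample space instead of the values of `Z`, so
that the same predictor can be used with a finer `Z`. -/
structure IsPredictor {X ι κ : Type*} [Fintype κ] (Z : X → ι) (r : X → κ → ℝ) : Prop where
  factorsThrough : r.FactorsThrough Z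
  nonneg : ∀ x k, 0 ≤ r x k
  sum_le_one : ∀ x, ∑ k, r x k ≤ 1

/-- The expected logarithmic loss of the predictor `r` of the variable `W`. It is meaningful only
if `r x (W x)` is almost surely positive, because `Real.log 0 = 0`. -/
noncomputable def logLoss {X κ : Type*} [MeasurableSpace X] (μ : Measure X) (r : X → κ → ℝ)
    (W : X → κ) : ℝ :=
  ∫ x, -Real.log (r x (W x)) ∂μ

namespace IsPredictor

variable {X ι κ : Type*} [Fintype κ] {Z : X → ι} {r : X → κ → ℝ}

theorem comp {X' : Type*} (hr : IsPredictor Z r) (T : X' → X) : IsPredictor (Z ∘ T) (r ∘ T) where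
  factorsThrough _ _ h := hr.factorsThrough h
  nonneg x := hr.nonneg (T x)
  sum_le_one x := hr.sum_le_one (T x)

theorem mono {ι' : Type*} {Z' : X → ι'} (hr : IsPredictor Z r) (hZ : Z.FactorsThrough Z') :
    IsPredictor Z' r where
  factorsThrough _ _ h := hr.factorsThrough (hZ h)
  nonneg := hr.nonneg
  sum_le_one := hr.sum_le_one

theorem mul {κ' : Type*} [Fintype κ'] {s : X → κ' → ℝ} (hr : IsPredictor Z r)
    (hs : IsPredictor Z s) : IsPredictor Z fun x (k : κ × κ') => r x k.1 * s x k.2 where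
  factorsThrough _ _ h := by simp only [hr.factorsThrough h, hs.factorsThrough h]
  nonneg x k := mul_nonneg (hr.nonneg x k.1) (hs.nonneg x k.2)
  sum_le_one x := by
    rw [Fintype.sum_prod_type, ← Fintype.sum_mul_sum]
    exact mul_le_one₀ (hr.sum_le_one x) (Finset.sum_nonneg fun k _ => hs.nonneg x k)
      (hs.sum_le_one x)

theorem integrable_neg_log [MeasurableSpace X] {μ : Measure X} [IsFiniteMeasure μ] [Finite ι]
    [MeasurableSpace ι] [MeasurableSingletonClass ι] [MeasurableSpace κ]
    [MeasurableSingletonClass κ] {W : X → κ} (hr : IsPredictor Z r) (hZ : Measurable Z)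
    (hW : Measurable W) : Integrable (fun x => -Real.log (r x (W x))) μ := by
  refine integrable_of_factorsThrough (hZ.prodMk hW) fun x y h => ?_
  obtain ⟨hZ_eq, hW_eq⟩ := Prod.mk.inj h
  simp only [hr.factorsThrough hZ_eq, hW_eq]

theorem exists_eq_comp (hr : IsPredictor Z r) :
    ∃ s : ι → κ → ℝ, r = s ∘ Z ∧ (∀ z k, 0 ≤ s z k) ∧ ∀ z, ∑ k, s z k ≤ 1 := by
  refine ⟨Function.extend Z r 0, funext fun x => (hr.factorsThrough.extend_apply 0 x).symm, ?_⟩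
  have zero_or_eq (z : ι) : Function.extend Z r 0 z = 0 ∨ ∃ x, Function.extend Z r 0 z = r x := by
    by_cases hz : ∃ x, Z x = z
    · obtain ⟨x, rfl⟩ := hz
      exact .inr ⟨x, hr.factorsThrough.extend_apply 0 x⟩
    · exact .inl (Function.extend_apply' _ _ _ hz)
  refine ⟨fun z k => ?_, fun z => ?_⟩ <;> rcases zero_or_eq z with h | ⟨x, h⟩
  · simp [h]
  · exact h ▸ hr.nonneg x k
  · simp [h]
  · exact h ▸ hr.sum_le_one x

end IsPredictor

section PartitionEntropy

variable {X ι κ : Type*} [MeasurableSpace X] {μ : Measure X} [IsProbabilityMeasure μ]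
  [Fintype ι] [MeasurableSpace ι] [MeasurableSingletonClass ι] {Z : X → ι} {W : X → κ}

theorem partitionEntropy_eq_integral (hZ : Measurable Z) :
    partitionEntropy μ Z = ∫ x, -Real.log (μ.real (Z ⁻¹' {Z x})) ∂μ := by
  rw [integral_comp_eq_sum hZ fun c => -Real.log (μ.real (Z ⁻¹' {c}))]
  simp only [partitionEntropy, Real.negMulLog, neg_mul, mul_neg]

theorem partitionEntropy_le_of_factorsThrough [Fintype κ] [MeasurableSpace κ]
    [MeasurableSingletonClass κ] (hZ : Measurable Z) (hW : W.FactorsThrough Z) :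
    partitionEntropy μ W ≤ partitionEntropy μ Z := by
  have hZ_ent : (fun x => -Real.log (μ.real (Z ⁻¹' {Z x}))).FactorsThrough Z :=
    fun x y h => by simp only [h]
  have hW_ent : (fun x => -Real.log (μ.real (W ⁻¹' {W x}))).FactorsThrough Z :=
    fun x y h => by simp only [hW h]
  rw [partitionEntropy_eq_integral hZ,
    partitionEntropy_eq_integral (measurable_of_factorsThrough hZ hW)]
  refine integral_mono_ae (integrable_of_factorsThrough hZ hW_ent)
    (integrable_of_factorsThrough hZ hZ_ent) ?_
  filter_upwards [ae_measureReal_preimage_singleton_pos (μ := μ) Z] with x hx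
  exact neg_le_neg (Real.log_le_log hx (measureReal_mono fun y hy => hW hy))

theorem partitionEntropy_le_integral_neg_log (hZ : Measurable Z) {s : ι → ℝ} (hs0 : ∀ c, 0 ≤ s c)
    (hs1 : ∑ c, s c ≤ 1) (hpos : ∀ᵐ x ∂μ, 0 < s (Z x)) :
    partitionEntropy μ Z ≤ ∫ x, -Real.log (s (Z x)) ∂μ := by
  set P : ι → ℝ := fun c => μ.real (Z ⁻¹' {c}) with hP
  have sum_P : ∑ c, P c = 1 := sum_measureReal_preimage_singleton_univ hZ
  have log_sum (c : ι) : Real.negMulLog (P c) ≤ P c * -Real.log (s c) + (s c - P c) := by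
    rcases (measureReal_nonneg (μ := μ) (s := Z ⁻¹' {c})).eq_or_lt' with hc | hc
    · simp [hP, hc, hs0 c]
    obtain ⟨x, rfl, hx⟩ : ∃ x, Z x = c ∧ 0 < s (Z x) := by
      by_contra! h
      refine hc.ne' ((measureReal_eq_zero_iff).2 (measure_eq_zero_iff_ae_notMem.2 ?_))
      filter_upwards [hpos] with x hx hxc using (h x hxc).not_gt hx
    have := mul_le_mul_of_nonneg_left (Real.log_le_sub_one_of_pos (div_pos hx hc)) hc.le
    rw [Real.log_div hx.ne' hc.ne', mul_sub, mul_sub, mul_div_cancel₀ _ hc.ne', mul_one] at this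
    simp only [Real.negMulLog, hP]
    linarith
  calc partitionEntropy μ Z ≤ ∑ c, (P c * -Real.log (s c) + (s c - P c)) :=
        Finset.sum_le_sum fun c _ => log_sum c
    _ = ∫ x, -Real.log (s (Z x)) ∂μ + (∑ c, s c - 1) := by
        rw [Finset.sum_add_distrib, Finset.sum_sub_distrib, sum_P,
          integral_comp_eq_sum hZ fun c => -Real.log (s c)]
    _ ≤ ∫ x, -Real.log (s (Z x)) ∂μ := by linarith

theorem partitionEntropy_prodMk_le [Fintype κ] [MeasurableSpace κ] [MeasurableSingletonClass κ]
    (hZ : Measurable Z) (hW : Measurable W) {r : X → κ → ℝ} (hr : IsPredictor Z r)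
    (hpos : ∀ᵐ x ∂μ, 0 < r x (W x)) :
    partitionEntropy μ (fun x => (Z x, W x)) ≤ partitionEntropy μ Z + logLoss μ r W := by
  obtain ⟨s, rfl, hs0, hs1⟩ := hr.exists_eq_comp
  set Q : ι → ℝ := fun z => μ.real (Z ⁻¹' {z})
  have sum_Q : ∑ z, Q z = 1 := sum_measureReal_preimage_singleton_univ hZ
  have sum_le : ∑ c : ι × κ, Q c.1 * s c.1 c.2 ≤ 1 := by
    calc ∑ c : ι × κ, Q c.1 * s c.1 c.2 = ∑ z, Q z * ∑ k, s z k := by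
          simp only [Fintype.sum_prod_type, Finset.mul_sum]
      _ ≤ ∑ z, Q z := Finset.sum_le_sum fun z _ =>
          mul_le_of_le_one_right measureReal_nonneg (hs1 z)
      _ = 1 := sum_Q
  have Q_pos := ae_measureReal_preimage_singleton_pos (μ := μ) Z
  refine (partitionEntropy_le_integral_neg_log (hZ.prodMk hW)
    (fun c => mul_nonneg measureReal_nonneg (hs0 c.1 c.2)) sum_le ?_).trans_eq ?_
  · filter_upwards [Q_pos, hpos] with x hx hx' using mul_pos hx hx'
  rw [partitionEntropy_eq_integral hZ, logLoss,
    ← integral_add (integrable_of_factorsThrough hZ fun x y h => by simp only [h])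
      (hr.integrable_neg_log hZ hW)]
  refine integral_congr_ae ?_
  filter_upwards [Q_pos, hpos] with x hx hx'
  simp only [Function.comp_apply] at hx' ⊢
  rw [Real.log_mul hx.ne' hx'.ne', neg_add]

end PartitionEntropy

section LogLoss

variable {X κ : Type*} [MeasurableSpace X] {μ : Measure X}

theorem logLoss_comp {T : X → X} (hT : MeasurePreserving T μ μ) {r : X → κ → ℝ} {W : X → κ}
    (hr : Integrable (fun x => -Real.log (r x (W x))) μ) :
    logLoss μ (r ∘ T) (W ∘ T) = logLoss μ r W := by
  simp only [logLoss]
  conv_rhs => rw [← hT.map_eq]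
  exact (integral_map hT.aemeasurable (hT.map_eq.symm ▸ hr.aestronglyMeasurable)).symm

theorem logLoss_mul {κ' : Type*} {r : X → κ → ℝ} {W : X → κ} {r' : X → κ' → ℝ} {W' : X → κ'}
    (hr : Integrable (fun x => -Real.log (r x (W x))) μ) (hpos : ∀ᵐ x ∂μ, 0 < r x (W x))
    (hr' : Integrable (fun x => -Real.log (r' x (W' x))) μ) (hpos' : ∀ᵐ x ∂μ, 0 < r' x (W' x)) :
    logLoss μ (fun x (k : κ × κ') => r x k.1 * r' x k.2) (fun x => (W x, W' x)) =
      logLoss μ r W + logLoss μ r' W' := by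
  simp only [logLoss]
  rw [← integral_add hr hr']
  refine integral_congr_ae ?_
  filter_upwards [hpos, hpos'] with x hx hx'
  rw [Real.log_mul hx.ne' hx'.ne', neg_add]

theorem partitionEntropy_le_add_logLoss [IsProbabilityMeasure μ] {ι ι' κ' : Type*} [Fintype ι]
    [MeasurableSpace ι] [MeasurableSingletonClass ι] [Fintype ι'] [MeasurableSpace ι']
    [MeasurableSingletonClass ι'] [Fintype κ] [MeasurableSpace κ] [MeasurableSingletonClass κ]
    [Fintype κ'] [MeasurableSpace κ'] [MeasurableSingletonClass κ'] {Z : X → ι} {Z' : X → ι'}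
    (hZ : Measurable Z) {S T : X → X} (hS : MeasurePreserving S μ μ)
    (hT : MeasurePreserving T μ μ) {W : X → κ} (hW : Measurable W) {W' : X → κ'}
    (hW' : Measurable W') (hZ' : Z'.FactorsThrough fun x => (Z x, W (S x), W' (T x)))
    {r : X → κ → ℝ} (hr : IsPredictor Z (r ∘ S))
    (hr_int : Integrable (fun x => -Real.log (r x (W x))) μ) (hpos : ∀ᵐ x ∂μ, 0 < r x (W x))
    {r' : X → κ' → ℝ} (hr' : IsPredictor Z (r' ∘ T))
    (hr'_int : Integrable (fun x => -Real.log (r' x (W' x))) μ)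
    (hpos' : ∀ᵐ x ∂μ, 0 < r' x (W' x)) :
    partitionEntropy μ Z' ≤ partitionEntropy μ Z + (logLoss μ r W + logLoss μ r' W') := by
  have next_meas : Measurable fun x => (W (S x), W' (T x)) :=
    (hW.comp hS.measurable).prodMk (hW'.comp hT.measurable)
  have hposS := hS.quasiMeasurePreserving.ae hpos
  have hposT := hT.quasiMeasurePreserving.ae hpos'
  calc partitionEntropy μ Z' ≤ partitionEntropy μ (fun x => (Z x, W (S x), W' (T x))) :=
        partitionEntropy_le_of_factorsThrough (hZ.prodMk next_meas) hZ'
    _ ≤ partitionEntropy μ Z + logLoss μ _ fun x => (W (S x), W' (T x)) := by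
        refine partitionEntropy_prodMk_le hZ next_meas (hr.mul hr') ?_
        filter_upwards [hposS, hposT] with x h h' using mul_pos h h'
    _ = partitionEntropy μ Z + (logLoss μ r W + logLoss μ r' W') := by
        rw [← logLoss_comp hS hr_int, ← logLoss_comp hT hr'_int]
        exact congrArg _ (logLoss_mul (hS.integrable_comp_of_integrable hr_int) hposS
          (hT.integrable_comp_of_integrable hr'_int) hposT)

end LogLoss

section NoisyPredictor

variable {X κ : Type*} [Fintype κ] [DecidableEq κ]

/-- Predicting the value of `ζ`, made strictly positive by mixing in the weight `t` at every
value. -/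
noncomputable def noisyPredictor (ζ : X → κ) (t : ℝ) (x : X) (c : κ) : ℝ :=
  ((if c = ζ x then 1 else 0) + t) / (1 + Fintype.card κ * t)

variable {ζ : X → κ} {t : ℝ}

theorem noisyPredictor_pos (ζ : X → κ) (ht : 0 < t) (x : X) (c : κ) : 0 < noisyPredictor ζ t x c :=
  div_pos (by split_ifs <;> linarith) (by positivity)

theorem isPredictor_noisyPredictor {ι : Type*} {Z : X → ι} (hζ : ζ.FactorsThrough Z) (ht : 0 < t) :
    IsPredictor Z (noisyPredictor ζ t) where
  factorsThrough x y h := by funext c; simp only [noisyPredictor, hζ h]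
  nonneg x c := (noisyPredictor_pos ζ ht x c).le
  sum_le_one x := by
    have : (1 + Fintype.card κ * t) ≠ 0 := by positivity
    simp [noisyPredictor, ← Finset.sum_div, Finset.sum_add_distrib, this]

theorem neg_log_noisyPredictor_le (ht : 0 < t) (x : X) (c : κ) :
    -Real.log (noisyPredictor ζ t x c) ≤
      Fintype.card κ * t + if ζ x ≠ c then |Real.log t| else 0 := by
  have hden : 0 < 1 + Fintype.card κ * t := by positivity
  have log_den := Real.log_le_sub_one_of_pos hden
  rw [noisyPredictor, Real.log_div (by split_ifs <;> positivity) hden.ne']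
  rcases eq_or_ne (ζ x) c with rfl | h
  · have : 0 ≤ Real.log (1 + t) := Real.log_nonneg (by linarith)
    simp only [if_true, ne_eq, not_true_eq_false, if_false]
    linarith
  · simp only [if_neg h.symm, if_pos h, zero_add]
    linarith [neg_abs_le (Real.log t)]

theorem logLoss_noisyPredictor_le [MeasurableSpace X] {μ : Measure X} [IsProbabilityMeasure μ]
    [MeasurableSpace κ] [MeasurableSingletonClass κ] {ξ : X → κ} (hζ : Measurable ζ)
    (hξ : Measurable ξ) (ht : 0 < t) :
    logLoss μ (noisyPredictor ζ t) ξ ≤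
      Fintype.card κ * t + μ.real {x | ζ x ≠ ξ x} * |Real.log t| := by
  have hne : MeasurableSet {x | ζ x ≠ ξ x} := (measurableSet_eq_fun hζ hξ).compl
  have hind : Integrable ({x | ζ x ≠ ξ x}.indicator fun _ => |Real.log t|) μ :=
    (integrable_const _).indicator hne
  have hloss : Integrable (fun x => -Real.log (noisyPredictor ζ t x (ξ x))) μ :=
    (isPredictor_noisyPredictor (fun _ _ h => h) ht).integrable_neg_log hζ hξ
  calc logLoss μ (noisyPredictor ζ t) ξ
      ≤ ∫ x, (Fintype.card κ * t + {x | ζ x ≠ ξ x}.indicator (fun _ => |Real.log t|) x) ∂μ :=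
        integral_mono hloss ((integrable_const _).add hind) fun x => by
          simpa only [indicator_apply, mem_ofPred_eq] using neg_log_noisyPredictor_le ht x (ξ x)
    _ = Fintype.card κ * t + μ.real {x | ζ x ≠ ξ x} * |Real.log t| := by
        rw [integral_add (integrable_const _) hind, integral_indicator_const _ hne]
        simp

end NoisyPredictor

theorem entropyOfPartition_le_of_partitionEntropy_succ_le {X ι : Type*} [MeasurableSpace X]
    {μ : Measure X} [IsProbabilityMeasure μ] [Fintype ι] [MeasurableSpace ι]
    [MeasurableSingletonClass ι] {T : X → X} {ξ : X → ι} {Y : ℕ → Type*} [∀ N, Fintype (Y N)]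
    [∀ N, MeasurableSpace (Y N)] [∀ N, MeasurableSingletonClass (Y N)] {Z : ∀ N, X → Y N}
    (hZ : ∀ N, Measurable (Z N)) (hξ : ∀ N, (itinerary T ξ N).FactorsThrough (Z N)) {C : ℝ}
    (hC : ∀ N, partitionEntropy μ (Z (N + 1)) ≤ partitionEntropy μ (Z N) + C) :
    entropyOfPartition T μ ξ ≤ C := by
  have entropy_le (N : ℕ) : partitionEntropy μ (Z N) ≤ partitionEntropy μ (Z 0) + N * C := by
    induction N with
    | zero => simp
    | succ N ih =>
      push_cast
      linarith [hC N]
  have rate_le : ∀ᶠ N : ℕ in atTop, ((partitionEntropy μ (itinerary T ξ N) / N : ℝ) : EReal) ≤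
      ((partitionEntropy μ (Z 0) / N + C : ℝ) : EReal) := by
    filter_upwards [eventually_gt_atTop 0] with N hN
    have hN' : (0 : ℝ) < N := by exact_mod_cast hN
    rw [EReal.coe_le_coe_iff, div_add' _ _ _ hN'.ne', mul_comm C]
    gcongr
    exact (partitionEntropy_le_of_factorsThrough (hZ N) (hξ N)).trans (entropy_le N)
  have rate_tendsto : Tendsto (fun N : ℕ => ((partitionEntropy μ (Z 0) / N + C : ℝ) : EReal)) atTop
      (𝓝 (C : EReal)) := by
    refine (continuous_coe_real_ereal.tendsto C).comp ?_
    simpa using (tendsto_const_div_atTop_nhds_zero_nat (partitionEntropy μ (Z 0))).add_const C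
  exact (limsup_le_limsup rate_le).trans_eq rate_tendsto.limsup_eq

/-! ### An upper bound for the entropy of the shift -/

theorem exists_dependsOn_measure_ne_lt {ι κ : Type*} {α : ι → Type*} [∀ i, MeasurableSpace (α i)]
    {μ : Measure (Π i, α i)} [IsFiniteMeasure μ] [Finite κ] [MeasurableSpace κ]
    [MeasurableSingletonClass κ] {ξ : (Π i, α i) → κ} (hξ : Measurable ξ) {ε : ENNReal}
    (hε : ε ≠ 0) :
    ∃ (s : Finset ι) (ζ : (Π i, α i) → κ), DependsOn ζ s ∧ μ {σ | ζ σ ≠ ξ σ} < ε := by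
  classical
  rcases isEmpty_or_nonempty (Π i, α i) with h_empty | ⟨⟨σ₀⟩⟩
  · exact ⟨∅, ξ, fun σ => (h_empty.false σ).elim, by simpa using hε.bot_lt⟩
  have : Nonempty κ := ⟨ξ σ₀⟩
  obtain ⟨ε', hε'_pos, hε'_sum⟩ := ENNReal.exists_pos_sum_of_countable hε κ
  have approx (c : κ) := exists_measure_symmDiff_lt_of_generateFrom_isSetRing (μ := μ)
    (C := measurableCylinders α) isSetRing_measurableCylinders
    ⟨{univ}, countable_singleton _, singleton_subset_iff.2 (univ_mem_measurableCylinders α),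
      by simp⟩
    generateFrom_measurableCylinders.symm (hξ (measurableSet_singleton c))
    (ε := ε' c) (by simpa using hε'_pos c)
  choose B hB_cyl hB using approx
  choose s S _ hBS using fun c => (mem_measurableCylinders _).1 (hB_cyl c)
  let _ := Fintype.ofFinite κ
  refine ⟨Finset.univ.biUnion s, fun σ => Classical.epsilon fun c => σ ∈ B c, ?_, ?_⟩
  · intro σ τ h
    have mem_iff (c : κ) : σ ∈ B c ↔ τ ∈ B c := by
      have : (s c).restrict σ = (s c).restrict τ := funext fun i =>
        h i (Finset.mem_coe.2 (Finset.mem_biUnion.2 ⟨c, Finset.mem_univ c, i.2⟩))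
      rw [hBS, mem_cylinder, mem_cylinder, this]
    simp only [mem_iff]
  · have ne_subset : {σ | Classical.epsilon (fun c => σ ∈ B c) ≠ ξ σ} ⊆
        ⋃ c, symmDiff (B c) (ξ ⁻¹' {c}) := by
      intro σ hσ
      by_contra h
      simp only [mem_iUnion, not_exists, mem_symmDiff, mem_preimage, mem_singleton_iff] at h
      have mem_iff (c : κ) : σ ∈ B c ↔ c = ξ σ := by grind
      simp only [mem_iff, mem_ofPred_eq, Classical.epsilon_singleton, ne_eq,
        not_true_eq_false] at hσ
    calc μ _ ≤ ∑' c, μ (symmDiff (B c) (ξ ⁻¹' {c})) :=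
          (measure_mono ne_subset).trans (measure_iUnion_le _)
      _ ≤ ∑' c, (ε' c : ENNReal) := ENNReal.tsum_le_tsum fun c => (hB c).le
      _ < ε := hε'_sum

/-- The block `σ_j, …, σ_{j+n-1}` of a two-sided sequence. -/
def window {E : Type*} (j : ℤ) (n : ℕ) (σ : ℤ → E) : Fin n → E := fun i => σ (j + (i : ℕ))

section Window

variable {E : Type*}

theorem window_eq_iff {j : ℤ} {n : ℕ} {σ τ : ℤ → E} :
    window j n σ = window j n τ ↔ ∀ i, j ≤ i → i < j + n → σ i = τ i := by
  refine ⟨fun h i hji hin => ?_, fun h => funext fun i => h _ (by lia) (by have := i.2; lia)⟩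
  obtain ⟨k, rfl⟩ := Int.le.dest hji
  exact congrFun h ⟨k, by lia⟩

theorem window_succ_eq_snoc (j : ℤ) (n : ℕ) (σ : ℤ → E) :
    window j (n + 1) σ = Fin.snoc (α := fun _ => E) (window j n σ) (σ (j + n)) := by
  funext i
  refine Fin.lastCases ?_ (fun i => ?_) i <;> simp [window]

theorem window_succ_eq_cons (j : ℤ) (n : ℕ) (σ : ℤ → E) :
    window j (n + 1) σ = Fin.cons (α := fun _ => E) (σ j) (window (j + 1) n σ) := by
  funext i
  refine Fin.cases ?_ (fun i => ?_) i <;> simp [window, add_assoc, add_comm (1 : ℤ)]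

theorem measurable_window [MeasurableSpace E] (j : ℤ) (n : ℕ) : Measurable (window (E := E) j n) :=
  measurable_pi_lambda _ fun _ => measurable_pi_apply _

theorem exists_factorsThrough_window {κ : Type*} {s : Finset ℤ} {ζ : (ℤ → E) → κ}
    (hζ : DependsOn ζ s) :
    ∃ m₀ : ℕ, ∀ m ≥ m₀, ζ.FactorsThrough (window (-(m : ℤ)) (2 * m + 1)) := by
  refine ⟨∑ i ∈ s, i.natAbs, fun m hm σ τ h => hζ fun i hi => ?_⟩
  have : i.natAbs ≤ m := (Finset.single_le_sum_of_canonicallyOrdered hi).trans hm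
  exact window_eq_iff.1 h i (by lia) (by lia)

end Window

theorem codeShift_iterate {E : Type*} (n : ℕ) (σ : ℤ → E) :
    (codeShift E)^[n] σ = fun k => σ (k + n) := by
  induction n with
  | zero => simp
  | succ n ih =>
    rw [Function.iterate_succ_apply', ih]
    simp [codeShift, add_assoc, add_comm (1 : ℤ)]

theorem measurable_codeShift {E : Type*} [MeasurableSpace E] : Measurable (codeShift E) :=
  measurable_pi_lambda _ fun _ => measurable_pi_apply _

theorem measurable_itinerary {X ι : Type*} [MeasurableSpace X] [MeasurableSpace ι] {T : X → X}
    (hT : Measurable T) {ξ : X → ι} (hξ : Measurable ξ) (N : ℕ) : Measurable (itinerary T ξ N) :=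
  measurable_pi_lambda _ fun j => hξ.comp (hT.iterate j)

theorem itinerary_succ_eq_snoc {X ι : Type*} (T : X → X) (ξ : X → ι) (N : ℕ) (x : X) :
    itinerary T ξ (N + 1) x = Fin.snoc (α := fun _ => ι) (itinerary T ξ N x) (ξ (T^[N] x)) := by
  funext j
  refine Fin.lastCases ?_ (fun j => ?_) j <;> simp [itinerary]

section CodeSpace

variable {E : Type*} [MeasurableSpace E] [DiscreteMeasurableSpace E] {Λ : Measure (ℤ → E)}

theorem exists_predictor_logLoss_le [Finite E] [IsProbabilityMeasure Λ] {κ : Type*} [Fintype κ]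
    [MeasurableSpace κ] [MeasurableSingletonClass κ] {ξ : (ℤ → E) → κ} (hξ : Measurable ξ) {η : ℝ}
    (hη : 0 < η) :
    ∃ (m₀ : ℕ) (ρ : (ℤ → E) → κ → ℝ), (∀ σ c, 0 < ρ σ c) ∧
      (∀ m ≥ m₀, IsPredictor (window (-(m : ℤ)) (2 * m + 1)) ρ) ∧ logLoss Λ ρ ξ ≤ η := by
  classical
  set t : ℝ := η / (2 * (Fintype.card κ + 1)) with ht_def
  have ht : 0 < t := by positivity
  have hlog : 0 < 2 * (|Real.log t| + 1) := by positivity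
  have hε : ENNReal.ofReal (η / (2 * (|Real.log t| + 1))) ≠ 0 := by simpa using div_pos hη hlog
  obtain ⟨s, ζ, hζs, hζξ⟩ := exists_dependsOn_measure_ne_lt (μ := Λ) hξ hε
  obtain ⟨m₀, hζ⟩ := exists_factorsThrough_window hζs
  have hζm : Measurable ζ := measurable_of_factorsThrough (measurable_window _ _) (hζ m₀ le_rfl)
  refine ⟨m₀, noisyPredictor ζ t, noisyPredictor_pos ζ ht,
    fun m hm => isPredictor_noisyPredictor (hζ m hm) ht, ?_⟩
  have mixing_le : Fintype.card κ * t ≤ η / 2 := by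
    rw [ht_def, mul_div_assoc', div_le_div_iff₀ (by positivity) two_pos]
    linarith
  have error_le : Λ.real {σ | ζ σ ≠ ξ σ} * |Real.log t| ≤ η / 2 := by
    have ne_le := (ENNReal.toReal_lt_of_lt_ofReal hζξ).le
    rw [le_div_iff₀ hlog, ← measureReal_def] at ne_le
    linarith [measureReal_nonneg (μ := Λ) (s := {σ | ζ σ ≠ ξ σ})]
  exact (logLoss_noisyPredictor_le hζm hξ ht).trans (by linarith)

/-- The joint past of the `ξ`-itinerary and of the code grows by one symbol of each kind per step;
`ρ` predicts the former and `q` the latter. -/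
theorem entropyOfPartition_codeShift_le [Fintype E] (hΛ : Λ ∈ invariantProb (codeShift E))
    {κ : Type*} [Fintype κ] [MeasurableSpace κ] [MeasurableSingletonClass κ] {ξ : (ℤ → E) → κ}
    (hξ : Measurable ξ) {m : ℕ} {ρ : (ℤ → E) → κ → ℝ}
    (hρ : IsPredictor (window (-(m : ℤ)) (2 * m + 1)) ρ) (hρ_pos : ∀ᵐ σ ∂Λ, 0 < ρ σ (ξ σ))
    {q : (ℤ → E) → E → ℝ} (hq : IsPredictor (window (-(m : ℤ)) (m + 1)) q)
    (hq_pos : ∀ᵐ σ ∂Λ, 0 < q σ (σ 1)) :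
    entropyOfPartition (codeShift E) Λ ξ ≤ (logLoss Λ ρ ξ + logLoss Λ q (· 1) : ℝ) := by
  obtain ⟨_, hS⟩ := hΛ
  have hρ_int := hρ.integrable_neg_log (μ := Λ) (measurable_window _ _) hξ
  have hq_int := hq.integrable_neg_log (μ := Λ) (measurable_window _ _) (measurable_pi_apply 1)
  set past : ∀ N, (ℤ → E) → (Fin N → κ) × (Fin (2 * m + 1 + N) → E) :=
    fun N σ => (itinerary (codeShift E) ξ N σ, window (-(m : ℤ)) (2 * m + 1 + N) σ)
  have past_meas (N : ℕ) : Measurable (past N) :=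
    (measurable_itinerary measurable_codeShift hξ N).prodMk (measurable_window _ _)
  refine entropyOfPartition_le_of_partitionEntropy_succ_le past_meas
    (fun N _ _ h => congrArg Prod.fst h) fun N => ?_
  have past_succ : (past (N + 1)).FactorsThrough fun σ =>
      (past N σ, ξ ((codeShift E)^[N] σ), (codeShift E)^[m + N] σ 1) := by
    intro σ τ h
    simp only [past, Prod.mk.injEq, codeShift_iterate] at h ⊢
    obtain ⟨⟨h_itinerary, h_window⟩, h_ξ, h_code⟩ := h
    have index_eq : (-(m : ℤ) + (2 * m + 1 + N : ℕ)) = 1 + (m + N : ℕ) := by lia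
    rw [itinerary_succ_eq_snoc, itinerary_succ_eq_snoc, h_itinerary, codeShift_iterate,
      codeShift_iterate, h_ξ, ← add_assoc, window_succ_eq_snoc, window_succ_eq_snoc, h_window,
      index_eq, h_code]
    exact ⟨rfl, rfl⟩
  have hρN : IsPredictor (past N) (ρ ∘ (codeShift E)^[N]) :=
    (hρ.comp _).mono fun σ τ h => window_eq_iff.2 fun i hi hi' => by
      simp only [codeShift_iterate]
      exact window_eq_iff.1 (congrArg Prod.snd h) _ (by lia) (by lia)
  have hqN : IsPredictor (past N) (q ∘ (codeShift E)^[m + N]) :=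
    (hq.comp _).mono fun σ τ h => window_eq_iff.2 fun i hi hi' => by
      simp only [codeShift_iterate]
      exact window_eq_iff.1 (congrArg Prod.snd h) _ (by lia) (by lia)
  exact partitionEntropy_le_add_logLoss (past_meas N) (hS.iterate N) (hS.iterate (m + N)) hξ
    (measurable_pi_apply 1) past_succ hρN hρ_int hρ_pos hqN hq_int hq_pos

theorem ksEntropy_codeShift_le [Fintype E] (hΛ : Λ ∈ invariantProb (codeShift E))
    {q : (ℤ → E) → E → ℝ} {n : ℕ} (hq : IsPredictor (window (-(n : ℤ)) (n + 1)) q)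
    (hq_pos : ∀ᵐ σ ∂Λ, 0 < q σ (σ 1)) :
    ksEntropy (codeShift E) Λ ≤ (logLoss Λ q (· 1) : ℝ) := by
  have := hΛ.1
  refine iSup_le fun k => iSup_le fun ξ => iSup_le fun hξ => EReal.le_of_forall_lt_iff_le.1 ?_
  intro c hc
  rw [EReal.coe_lt_coe_iff] at hc
  obtain ⟨m₀, ρ, hρ_pos, hρ, hρ_loss⟩ := exists_predictor_logLoss_le (Λ := Λ) hξ (sub_pos.2 hc)
  have hq' : IsPredictor (window (-((max m₀ n : ℕ) : ℤ)) (max m₀ n + 1)) q :=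
    hq.mono fun σ τ h => window_eq_iff.2 fun i hi hi' => window_eq_iff.1 h i (by lia) (by lia)
  refine (entropyOfPartition_codeShift_le hΛ hξ (hρ _ (le_max_left _ _))
    (ae_of_all _ fun σ => hρ_pos σ _) hq' hq_pos).trans ?_
  exact_mod_cast (by linarith : logLoss Λ ρ ξ + logLoss Λ q (· 1) ≤ c)

end CodeSpace

/-! ### Finite words of a Markov system -/

section Words

variable {E M : Type*} [Fintype E] [AddCommMonoid M] {n : ℕ}

theorem sum_word_succ_cons (f : (Fin (n + 1) → E) → M) :
    ∑ u, f u = ∑ e, ∑ u : Fin n → E, f (Fin.cons e u) := by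
  rw [← Fintype.sum_prod_type', ← (Fin.consEquiv fun _ : Fin (n + 1) => E).sum_comp]
  rfl

theorem sum_word_succ_snoc (f : (Fin (n + 1) → E) → M) :
    ∑ u, f u = ∑ u : Fin n → E, ∑ e, f (Fin.snoc (α := fun _ => E) u e) := by
  rw [Finset.sum_comm, ← Fintype.sum_prod_type',
    ← (Fin.snocEquiv fun _ : Fin (n + 1) => E).sum_comp]
  rfl

end Words

namespace MarkovSystem

variable {V E K : Type*} [Fintype E] [MeasurableSpace K]

/-- The probability that the Markov system started at `y` follows the word `u`. -/
noncomputable def wordProb (𝓜 : MarkovSystem V E K) : {n : ℕ} → (Fin n → E) → K → ℝ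
  | 0, _, _ => 1
  | _ + 1, u, y => 𝓜.p (u 0) y * 𝓜.wordProb (Fin.tail u) (𝓜.w (u 0) y)

/-- The point reached from `y` along the word `u`. -/
def wordMap (𝓜 : MarkovSystem V E K) : {n : ℕ} → (Fin n → E) → K → K
  | 0, _, y => y
  | _ + 1, u, y => 𝓜.wordMap (Fin.tail u) (𝓜.w (u 0) y)

/-- The probability of the word `u` for the Markov system with initial distribution `μ`. -/
noncomputable def blockProb (𝓜 : MarkovSystem V E K) (μ : Measure K) {n : ℕ} (u : Fin n → E) : ℝ :=
  ∫ y, 𝓜.wordProb u y ∂μ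

/-- Two points lie in the same vertex set. -/
def SameCell (𝓜 : MarkovSystem V E K) (y z : K) : Prop :=
  ∃ v, y ∈ 𝓜.vertexSet v ∧ z ∈ 𝓜.vertexSet v

/-- The entropy of the choice of an edge at `y`. -/
noncomputable def stepEntropy (𝓜 : MarkovSystem V E K) (y : K) : ℝ :=
  ∑ e, Real.negMulLog (𝓜.p e y)

section Basic

variable (𝓜 : MarkovSystem V E K) {n : ℕ}

theorem mem_of_p_ne_zero {e : E} {y : K} (h : 𝓜.p e y ≠ 0) : y ∈ 𝓜.vertexSet (𝓜.ini e) :=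
  not_imp_comm.1 (𝓜.p_zero e y) h

theorem eq_of_mem_vertexSet {v v' : V} {y : K} (h : y ∈ 𝓜.vertexSet v)
    (h' : y ∈ 𝓜.vertexSet v') : v = v' :=
  not_imp_comm.1 (𝓜.vertexSet_disjoint v v') fun hd => hd.notMem_of_mem_left h h'

theorem exists_mem_vertexSet (y : K) : ∃ v, y ∈ 𝓜.vertexSet v :=
  mem_iUnion.1 (𝓜.vertexSet_cover.symm ▸ mem_univ y)

theorem ini_surjective : Function.Surjective 𝓜.ini := fun v => by
  obtain ⟨y, hy⟩ := 𝓜.vertexSet_nonempty v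
  obtain ⟨e, -, he⟩ := Finset.exists_ne_zero_of_sum_ne_zero ((𝓜.p_sum y).trans_ne one_ne_zero)
  exact ⟨e, 𝓜.eq_of_mem_vertexSet (𝓜.mem_of_p_ne_zero he) hy⟩

theorem p_le_one (e : E) (y : K) : 𝓜.p e y ≤ 1 :=
  𝓜.p_sum y ▸ Finset.single_le_sum (fun e _ => 𝓜.p_nonneg e y) (Finset.mem_univ e)

variable {𝓜} in
theorem SameCell.map {y z : K} (h : 𝓜.SameCell y z) {e : E} (he : 𝓜.p e y ≠ 0) :
    𝓜.SameCell (𝓜.w e y) (𝓜.w e z) := by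
  obtain ⟨v, hy, hz⟩ := h
  obtain rfl := 𝓜.eq_of_mem_vertexSet hy (𝓜.mem_of_p_ne_zero he)
  exact ⟨_, 𝓜.w_mapsTo e hy, 𝓜.w_mapsTo e hz⟩

theorem wordProb_cons (e : E) (u : Fin n → E) (y : K) :
    𝓜.wordProb (Fin.cons (α := fun _ => E) e u) y = 𝓜.p e y * 𝓜.wordProb u (𝓜.w e y) := by
  simp [wordProb]

theorem wordMap_cons (e : E) (u : Fin n → E) (y : K) :
    𝓜.wordMap (Fin.cons (α := fun _ => E) e u) y = 𝓜.wordMap u (𝓜.w e y) := by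
  simp [wordMap]

theorem wordMap_snoc (u : Fin n → E) (e : E) (y : K) :
    𝓜.wordMap (Fin.snoc (α := fun _ => E) u e) y = 𝓜.w e (𝓜.wordMap u y) := by
  induction n generalizing y with
  | zero => simp [wordMap, Fin.snoc]
  | succ n ih =>
    obtain ⟨e', u, rfl⟩ : ∃ e' u', u = Fin.cons (α := fun _ => E) e' u' :=
      ⟨u 0, Fin.tail u, (Fin.cons_self_tail u).symm⟩
    rw [← Fin.cons_snoc_eq_snoc_cons, wordMap_cons, wordMap_cons, ih]

theorem wordProb_snoc (u : Fin n → E) (e : E) (y : K) :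
    𝓜.wordProb (Fin.snoc (α := fun _ => E) u e) y =
      𝓜.wordProb u y * 𝓜.p e (𝓜.wordMap u y) := by
  induction n generalizing y with
  | zero => simp [wordProb, wordMap, Fin.snoc]
  | succ n ih =>
    obtain ⟨e', u, rfl⟩ : ∃ e' u', u = Fin.cons (α := fun _ => E) e' u' :=
      ⟨u 0, Fin.tail u, (Fin.cons_self_tail u).symm⟩
    rw [← Fin.cons_snoc_eq_snoc_cons, wordProb_cons, wordProb_cons, wordMap_cons, ih, mul_assoc]

theorem wordProb_nonneg (u : Fin n → E) (y : K) : 0 ≤ 𝓜.wordProb u y := by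
  induction n generalizing y with
  | zero => simp [wordProb]
  | succ n ih => exact mul_nonneg (𝓜.p_nonneg _ _) (ih _ _)

theorem sum_wordProb_succ (y : K) (f : (Fin (n + 1) → E) → ℝ) :
    ∑ u, 𝓜.wordProb u y * f u =
      ∑ e, 𝓜.p e y * ∑ u : Fin n → E, 𝓜.wordProb u (𝓜.w e y) * f (Fin.cons e u) := by
  rw [sum_word_succ_cons]
  simp only [Finset.mul_sum, wordProb_cons, mul_assoc]

theorem sum_wordProb (n : ℕ) (y : K) : ∑ u : Fin n → E, 𝓜.wordProb u y = 1 := by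
  induction n generalizing y with
  | zero => simp [wordProb]
  | succ n ih => simpa [ih, 𝓜.p_sum] using 𝓜.sum_wordProb_succ (n := n) y fun _ => 1

theorem wordProb_le_one (u : Fin n → E) (y : K) : 𝓜.wordProb u y ≤ 1 :=
  𝓜.sum_wordProb n y ▸
    Finset.single_le_sum (fun u _ => 𝓜.wordProb_nonneg u y) (Finset.mem_univ u)

theorem abs_wordProb_le (u : Fin n → E) (y : K) : |𝓜.wordProb u y| ≤ 1 :=
  (abs_of_nonneg (𝓜.wordProb_nonneg u y)).trans_le (𝓜.wordProb_le_one u y)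

theorem measurable_wordMap (u : Fin n → E) : Measurable (𝓜.wordMap u) := by
  induction n with
  | zero => exact measurable_id
  | succ n ih => exact (ih (Fin.tail u)).comp (𝓜.w_measurable _)

theorem measurable_wordProb (u : Fin n → E) : Measurable (𝓜.wordProb u) := by
  induction n with
  | zero => exact measurable_const
  | succ n ih => exact (𝓜.p_measurable _).mul ((ih (Fin.tail u)).comp (𝓜.w_measurable _))

theorem measurable_markovOp {f : K → ℝ} (hf : Measurable f) : Measurable (𝓜.markovOp f) :=
  Finset.measurable_sum _ fun e _ => (𝓜.p_measurable e).mul (hf.comp (𝓜.w_measurable e))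

theorem abs_sum_p_mul_le {h : E → ℝ} {C : ℝ} (hC : ∀ e, |h e| ≤ C) (y : K) :
    |∑ e, 𝓜.p e y * h e| ≤ C := by
  calc |∑ e, 𝓜.p e y * h e| ≤ ∑ e, |𝓜.p e y * h e| := Finset.abs_sum_le_sum_abs _ _
    _ ≤ ∑ e, 𝓜.p e y * C := by
        refine Finset.sum_le_sum fun e _ => ?_
        rw [abs_mul, abs_of_nonneg (𝓜.p_nonneg e y)]
        exact mul_le_mul_of_nonneg_left (hC e) (𝓜.p_nonneg e y)
    _ = C := by rw [← Finset.sum_mul, 𝓜.p_sum, one_mul]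

theorem abs_markovOp_le {f : K → ℝ} {C : ℝ} (hC : ∀ y, |f y| ≤ C) (y : K) :
    |𝓜.markovOp f y| ≤ C :=
  𝓜.abs_sum_p_mul_le (fun _ => hC _) y

end Basic

theorem sum_wordProb_dist_le {K : Type*} [PseudoMetricSpace K] [MeasurableSpace K]
    {𝓜 : MarkovSystem V E K} {a : ℝ} (h : 𝓜.IsContractive a) (n : ℕ) {y z : K}
    (hyz : 𝓜.SameCell y z) :
    ∑ u : Fin n → E, 𝓜.wordProb u y * dist (𝓜.wordMap u y) (𝓜.wordMap u z) ≤
      a ^ n * dist y z := by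
  induction n generalizing y z with
  | zero => simp [wordProb, wordMap]
  | succ n ih =>
    simp only [sum_wordProb_succ, wordMap_cons]
    calc _ ≤ ∑ e, 𝓜.p e y * (a ^ n * dist (𝓜.w e y) (𝓜.w e z)) := by
          refine Finset.sum_le_sum fun e _ => ?_
          rcases eq_or_ne (𝓜.p e y) 0 with he | he
          · simp [he]
          · exact mul_le_mul_of_nonneg_left (ih (hyz.map he)) (𝓜.p_nonneg _ _)
      _ = a ^ n * ∑ e, 𝓜.p e y * dist (𝓜.w e y) (𝓜.w e z) := by
          simp only [Finset.mul_sum, mul_left_comm]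
      _ ≤ a ^ n * (a * dist y z) := by
          obtain ⟨v, hy, hz⟩ := hyz
          exact mul_le_mul_of_nonneg_left (h.2.2 v y hy z hz) (pow_nonneg h.1.le n)
      _ = a ^ (n + 1) * dist y z := by ring

section StepEntropy

variable (𝓜 : MarkovSystem V E K)

theorem measurable_stepEntropy : Measurable 𝓜.stepEntropy :=
  Finset.measurable_sum _ fun e _ => Real.continuous_negMulLog.measurable.comp (𝓜.p_measurable e)

theorem abs_negMulLog_le_one {t : ℝ} (h0 : 0 ≤ t) (h1 : t ≤ 1) : |Real.negMulLog t| ≤ 1 := by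
  rw [abs_of_nonneg (Real.negMulLog_nonneg h0 h1)]
  exact (Real.negMulLog_le_one_sub_self h0).trans (by linarith)

theorem abs_stepEntropy_le (y : K) : |𝓜.stepEntropy y| ≤ Fintype.card E := by
  calc |𝓜.stepEntropy y| ≤ ∑ e, |Real.negMulLog (𝓜.p e y)| := Finset.abs_sum_le_sum_abs _ _
    _ ≤ ∑ _e : E, 1 := Finset.sum_le_sum fun e _ =>
        abs_negMulLog_le_one (𝓜.p_nonneg e y) (𝓜.p_le_one e y)
    _ = Fintype.card E := by simp

theorem measurable_negMulLog_wordProb {n : ℕ} (u : Fin n → E) :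
    Measurable fun y => Real.negMulLog (𝓜.wordProb u y) :=
  Real.continuous_negMulLog.measurable.comp (𝓜.measurable_wordProb u)

theorem abs_negMulLog_wordProb_le {n : ℕ} (u : Fin n → E) (y : K) :
    |Real.negMulLog (𝓜.wordProb u y)| ≤ 1 :=
  abs_negMulLog_le_one (𝓜.wordProb_nonneg u y) (𝓜.wordProb_le_one u y)

theorem sum_negMulLog_wordProb_succ (n : ℕ) (y : K) :
    ∑ u : Fin (n + 1) → E, Real.negMulLog (𝓜.wordProb u y) =
      𝓜.stepEntropy y +
        𝓜.markovOp (fun z => ∑ u : Fin n → E, Real.negMulLog (𝓜.wordProb u z)) y := by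
  rw [sum_word_succ_cons]
  simp only [wordProb_cons, Real.negMulLog_mul, stepEntropy, markovOp]
  simp only [Finset.sum_add_distrib, ← Finset.sum_mul, ← Finset.mul_sum, 𝓜.sum_wordProb, one_mul]

end StepEntropy

section Invariant

variable {𝓜 : MarkovSystem V E K} {μ : Measure K}

theorem blockProb_nonneg (𝓜 : MarkovSystem V E K) (μ : Measure K) {n : ℕ} (u : Fin n → E) :
    0 ≤ 𝓜.blockProb μ u :=
  integral_nonneg fun y => 𝓜.wordProb_nonneg u y

theorem integrable_p [IsFiniteMeasure μ] (e : E) : Integrable (𝓜.p e) μ :=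
  .of_bound (𝓜.p_measurable e).aestronglyMeasurable 1 (ae_of_all _ fun y => by
    rw [Real.norm_of_nonneg (𝓜.p_nonneg e y)]
    exact 𝓜.p_le_one e y)

theorem integrable_wordProb [IsFiniteMeasure μ] {n : ℕ} (u : Fin n → E) :
    Integrable (𝓜.wordProb u) μ :=
  .of_bound (𝓜.measurable_wordProb u).aestronglyMeasurable 1 (ae_of_all _ (𝓜.abs_wordProb_le u))

variable [IsProbabilityMeasure μ]

theorem integral_markovOp (h_inv : 𝓜.adjointOp μ = μ) {f : K → ℝ} (hf : Measurable f) {C : ℝ}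
    (hC : ∀ y, |f y| ≤ C) : ∫ y, 𝓜.markovOp f y ∂μ = ∫ y, f y ∂μ := by
  rw [← 𝓜.integral_adjointOp μ f hf C hC, h_inv]

variable (𝓜 μ) in
theorem sum_blockProb (n : ℕ) : ∑ u : Fin n → E, 𝓜.blockProb μ u = 1 := by
  simp only [blockProb]
  rw [← integral_finsetSum _ fun u _ => integrable_wordProb u]
  simp [sum_wordProb]

theorem sum_blockProb_snoc (𝓜 : MarkovSystem V E K) (μ : Measure K) [IsFiniteMeasure μ] {n : ℕ}
    (u : Fin n → E) :
    ∑ e, 𝓜.blockProb μ (Fin.snoc (α := fun _ => E) u e) = 𝓜.blockProb μ u := by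
  simp only [blockProb]
  rw [← integral_finsetSum _ fun e _ => integrable_wordProb _]
  simp only [wordProb_snoc, ← Finset.mul_sum, 𝓜.p_sum, mul_one]

theorem sum_blockProb_cons (h_inv : 𝓜.adjointOp μ = μ) {n : ℕ} (u : Fin n → E) :
    ∑ e, 𝓜.blockProb μ (Fin.cons (α := fun _ => E) e u) = 𝓜.blockProb μ u := by
  simp only [blockProb]
  rw [← integral_finsetSum _ fun e _ => integrable_wordProb _,
    ← integral_markovOp h_inv (𝓜.measurable_wordProb u) (𝓜.abs_wordProb_le u)]
  simp only [wordProb_cons, markovOp]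

theorem integral_sum_wordProb (h_inv : 𝓜.adjointOp μ = μ) (n : ℕ) {f : K → ℝ} (hf : Measurable f)
    {C : ℝ} (hC : ∀ y, |f y| ≤ C) :
    ∫ y, ∑ u : Fin n → E, 𝓜.wordProb u y * f (𝓜.wordMap u y) ∂μ = ∫ y, f y ∂μ := by
  induction n generalizing f with
  | zero => simp [wordProb, wordMap]
  | succ n ih =>
    rw [← integral_markovOp h_inv hf hC, ← ih (𝓜.measurable_markovOp hf) (𝓜.abs_markovOp_le hC)]
    simp only [sum_word_succ_snoc, wordProb_snoc, wordMap_snoc, markovOp, Finset.mul_sum, mul_assoc]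

theorem integral_sum_negMulLog_wordProb (h_inv : 𝓜.adjointOp μ = μ) (n : ℕ) :
    ∫ y, ∑ u : Fin n → E, Real.negMulLog (𝓜.wordProb u y) ∂μ = n * ∫ y, 𝓜.stepEntropy y ∂μ := by
  induction n with
  | zero => simp [wordProb]
  | succ n ih =>
    have entropy_meas : Measurable fun z => ∑ u : Fin n → E, Real.negMulLog (𝓜.wordProb u z) :=
      Finset.measurable_sum _ fun u _ => 𝓜.measurable_negMulLog_wordProb u
    have entropy_bdd (z : K) : |∑ u : Fin n → E, Real.negMulLog (𝓜.wordProb u z)| ≤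
        ∑ _u : Fin n → E, 1 := (Finset.abs_sum_le_sum_abs _ _).trans
      (Finset.sum_le_sum fun u _ => 𝓜.abs_negMulLog_wordProb_le u z)
    simp only [sum_negMulLog_wordProb_succ]
    rw [integral_add
      (.of_bound 𝓜.measurable_stepEntropy.aestronglyMeasurable _
        (ae_of_all _ 𝓜.abs_stepEntropy_le))
      (.of_bound (𝓜.measurable_markovOp entropy_meas).aestronglyMeasurable _
        (ae_of_all _ (𝓜.abs_markovOp_le entropy_bdd))),
      integral_markovOp h_inv entropy_meas entropy_bdd, ih]
    push_cast
    ring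

theorem le_sum_negMulLog_blockProb (h_inv : 𝓜.adjointOp μ = μ) (n : ℕ) :
    n * ∫ y, 𝓜.stepEntropy y ∂μ ≤ ∑ u : Fin n → E, Real.negMulLog (𝓜.blockProb μ u) := by
  have hi (u : Fin n → E) : Integrable (fun y => Real.negMulLog (𝓜.wordProb u y)) μ :=
    .of_bound (𝓜.measurable_negMulLog_wordProb u).aestronglyMeasurable 1
      (ae_of_all _ (𝓜.abs_negMulLog_wordProb_le u))
  rw [← integral_sum_negMulLog_wordProb h_inv, integral_finsetSum _ fun u _ => hi u]
  refine Finset.sum_le_sum fun u _ => ?_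
  exact Real.concaveOn_negMulLog.le_map_integral Real.continuous_negMulLog.continuousOn isClosed_Ici
    (ae_of_all _ fun y => 𝓜.wordProb_nonneg u y) (integrable_wordProb u) (hi u)

end Invariant

end MarkovSystem

/-! ### Stationary measures with given block laws -/

/-- The family of laws of the blocks of length `n = 0, 1, 2, …` of a stationary process with values
in `E`, as probability weights on words. -/
structure IsStationaryBlockLaw {E : Type*} [Fintype E] (P : ∀ n, (Fin n → E) → ℝ) : Prop where
  nonneg : ∀ n u, 0 ≤ P n u
  sum_eq_one : ∀ n, ∑ u, P n u = 1
  sum_snoc : ∀ n (u : Fin n → E), ∑ e, P (n + 1) (Fin.snoc (α := fun _ => E) u e) = P n u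
  sum_cons : ∀ n (u : Fin n → E), ∑ e, P (n + 1) (Fin.cons (α := fun _ => E) e u) = P n u

theorem codeShift_zpow_apply {E : Type*} (j k : ℤ) (σ : ℤ → E) :
    (codeShift E ^ j : Equiv.Perm (ℤ → E)) σ k = σ (k + j) := by
  induction j generalizing σ with
  | zero => simp
  | succ n ih =>
    rw [zpow_add_one, Equiv.Perm.mul_apply, ih]
    exact congrArg σ (by ring)
  | pred n ih =>
    rw [zpow_sub_one, Equiv.Perm.mul_apply, ih]
    exact congrArg σ (by ring)

theorem measurable_codeShift_zpow {E : Type*} [MeasurableSpace E] (j : ℤ) :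
    Measurable (codeShift E ^ j : Equiv.Perm (ℤ → E)) :=
  measurable_pi_lambda _ fun k => by
    simpa only [codeShift_zpow_apply] using measurable_pi_apply (k + j)

theorem measurePreserving_codeShift_zpow {E : Type*} [MeasurableSpace E] {Λ : Measure (ℤ → E)}
    (hΛ : Λ ∈ invariantProb (codeShift E)) (j : ℤ) :
    MeasurePreserving (codeShift E ^ j : Equiv.Perm (ℤ → E)) Λ Λ := by
  have pow_preserving (n : ℕ) :
      MeasurePreserving (codeShift E ^ (n : ℤ) : Equiv.Perm (ℤ → E)) Λ Λ := by
    rw [zpow_natCast, ← Equiv.Perm.iterate_eq_pow]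
    exact hΛ.2.iterate n
  obtain ⟨n, rfl | rfl⟩ := j.eq_nat_or_neg
  · exact pow_preserving n
  · refine ⟨measurable_codeShift_zpow _, ?_⟩
    conv_lhs => rw [← (pow_preserving n).map_eq]
    rw [Measure.map_map (measurable_codeShift_zpow _) (measurable_codeShift_zpow _),
      ← Equiv.Perm.coe_mul, ← zpow_add, neg_add_cancel, zpow_zero, Equiv.Perm.coe_one,
      Measure.map_id]

theorem window_codeShift {E : Type*} (j : ℤ) (n : ℕ) (σ : ℤ → E) :
    window j n (codeShift E σ) = window (j + 1) n σ :=
  funext fun i => congrArg σ (by ring)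

theorem window_surjective {E : Type*} [Nonempty E] (j : ℤ) (n : ℕ) :
    Function.Surjective (window (E := E) j n) :=
  Function.Injective.surjective_comp_right (f := fun i : Fin n => j + ((i : ℕ) : ℤ))
    fun i i' h => Fin.ext (by simpa using h)

section WindowLaw

variable {E : Type*} [MeasurableSpace E] [DiscreteMeasurableSpace E]

theorem measurableSet_preimage_window [Finite E] (j : ℤ) {n : ℕ} (A : Set (Fin n → E)) :
    MeasurableSet (window j n ⁻¹' A) :=
  measurable_window j n A.toFinite.measurableSet

theorem sum_measureReal_preimage_apply {X ι κ : Type*} [MeasurableSpace X] {μ : Measure X}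
    [IsFiniteMeasure μ] [Fintype κ] [MeasurableSpace ι] [MeasurableSingletonClass ι] {Z : X → ι}
    (hZ : Measurable Z) {g : κ → ι} (hg : g.Injective) :
    ∑ k, μ.real (Z ⁻¹' {g k}) = μ.real (Z ⁻¹' range g) := by
  have := sum_measureReal_preimage_singleton (μ := μ) (Finset.univ.map ⟨g, hg⟩) (f := Z)
    fun y _ => hZ (measurableSet_singleton y)
  simpa using this

theorem measure_ext_of_window [Finite E] {ν ν' : Measure (ℤ → E)} [IsProbabilityMeasure ν]
    [IsProbabilityMeasure ν']
    (h : ∀ j n (u : Fin n → E), ν.real (window j n ⁻¹' {u}) = ν'.real (window j n ⁻¹' {u})) :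
    ν = ν' := by
  refine ext_of_generate_finite (measurableCylinders fun _ : ℤ => E)
    generateFrom_measurableCylinders.symm isPiSystem_measurableCylinders ?_ (by simp)
  intro A hA
  obtain ⟨s, S, -, rfl⟩ := (mem_measurableCylinders _).1 hA
  have depends : DependsOn (fun σ : ℤ → E => σ ∈ cylinder s S) (s : Set ℤ) := fun σ τ hστ => by
    have restrict_eq : s.restrict σ = s.restrict τ := funext fun i => hστ i i.2
    simp only [mem_cylinder, restrict_eq]
  obtain ⟨m, hm⟩ := exists_factorsThrough_window depends
  set Z : (ℤ → E) → (Fin (2 * m + 1) → E) := window (-(m : ℤ)) (2 * m + 1)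
  have hZ : Measurable Z := measurable_window _ _
  have map_eq : ν.map Z = ν'.map Z := Measure.ext_of_singleton fun u => by
    simpa only [Measure.map_apply hZ (measurableSet_singleton u)] using
      (measureReal_eq_measureReal_iff).1 (h _ _ u)
  have cylinder_eq : cylinder s S = Z ⁻¹' (Z '' cylinder s S) := by
    refine (subset_preimage_image _ _).antisymm ?_
    rintro σ ⟨τ, hτ, hτσ⟩
    exact (hm m le_rfl hτσ).mp hτ
  rw [cylinder_eq, ← Measure.map_apply hZ (toFinite _).measurableSet,
    ← Measure.map_apply hZ (toFinite _).measurableSet, map_eq]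

theorem exists_measure_of_eventually_window [Finite E] (νs : ℕ → ProbabilityMeasure (ℤ → E))
    {P : ∀ n, (Fin n → E) → ℝ}
    (h : ∀ j n u, ∀ᶠ k in atTop, (νs k : Measure (ℤ → E)).real (window j n ⁻¹' {u}) = P n u) :
    ∃ ν : ProbabilityMeasure (ℤ → E), ∀ j n u,
      (ν : Measure (ℤ → E)).real (window j n ⁻¹' {u}) = P n u := by
  let _ : TopologicalSpace E := ⊥
  have _ : DiscreteTopology E := ⟨rfl⟩
  set U : Ultrafilter (ProbabilityMeasure (ℤ → E)) := (hyperfilter ℕ).map νs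
  have tendsto_lim : Tendsto νs (hyperfilter ℕ) (𝓝 U.lim) := U.le_nhds_lim
  refine ⟨U.lim, fun j n u => ?_⟩
  have hclopen : IsClopen (window j n ⁻¹' {u}) :=
    (isClopen_discrete _).preimage (continuous_pi fun _ => continuous_apply _)
  have tendsto_block := ProbabilityMeasure.tendsto_measure_of_null_frontier_of_tendsto' tendsto_lim
    (E := window j n ⁻¹' {u}) (by rw [hclopen.frontier_eq, measure_empty])
  refine tendsto_nhds_unique ((ENNReal.tendsto_toReal (measure_ne_top _ _)).comp tendsto_block)
    (tendsto_const_nhds.congr' ?_)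
  filter_upwards [(h j n u).filter_mono Nat.hyperfilter_le_atTop] with k hk using hk.symm

variable [Fintype E]

theorem measureReal_window_eq_sum_snoc (ν : Measure (ℤ → E)) [IsFiniteMeasure ν] (j : ℤ)
    {n : ℕ} (u : Fin n → E) :
    ν.real (window j n ⁻¹' {u}) =
      ∑ e, ν.real (window j (n + 1) ⁻¹' {Fin.snoc (α := fun _ => E) u e}) := by
  rw [sum_measureReal_preimage_apply (measurable_window _ _) fun e e' h => (Fin.snoc_inj.1 h).2]
  congr 1
  ext σ
  simp [window_succ_eq_snoc, Fin.snoc_inj, eq_comm]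

theorem measureReal_window_eq_sum_cons (ν : Measure (ℤ → E)) [IsFiniteMeasure ν] (j : ℤ)
    {n : ℕ} (u : Fin n → E) :
    ν.real (window (j + 1) n ⁻¹' {u}) =
      ∑ e, ν.real (window j (n + 1) ⁻¹' {Fin.cons (α := fun _ => E) e u}) := by
  rw [sum_measureReal_preimage_apply (measurable_window _ _) fun e e' h => (Fin.cons_inj.1 h).1]
  congr 1
  ext σ
  simp [window_succ_eq_cons, Fin.cons_inj, eq_comm]

variable {P : ∀ n, (Fin n → E) → ℝ}

namespace IsStationaryBlockLaw

theorem exists_probabilityMeasure_window (hP : IsStationaryBlockLaw P) (j : ℤ) (n : ℕ) :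
    ∃ ν : ProbabilityMeasure (ℤ → E), ∀ u, (ν : Measure (ℤ → E)).real (window j n ⁻¹' {u}) =
      P n u := by
  have : Nonempty E := by
    by_contra h
    rw [not_nonempty_iff] at h
    simpa using hP.sum_eq_one 1
  obtain ⟨extend, extend_window⟩ := (window_surjective (E := E) j n).hasRightInverse
  have weights_sum : ∑ u, ENNReal.ofReal (P n u) = 1 := by
    rw [← ENNReal.ofReal_sum_of_nonneg fun u _ => hP.nonneg n u, hP.sum_eq_one, ENNReal.ofReal_one]
  have extend_meas : Measurable extend := measurable_of_finite _
  set law := PMF.ofFintype _ weights_sum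
  refine ⟨⟨law.toMeasure.map extend, Measure.isProbabilityMeasure_map extend_meas.aemeasurable⟩,
    fun u => ?_⟩
  have preimage_eq : extend ⁻¹' (window j n ⁻¹' {u}) = {u} := by
    ext v
    simp [extend_window v]
  rw [ProbabilityMeasure.coe_mk, map_measureReal_apply extend_meas
    (measurableSet_preimage_window _ _), preimage_eq, measureReal_def,
    PMF.toMeasure_apply_singleton _ _ (measurableSet_singleton u), PMF.ofFintype_apply,
    ENNReal.toReal_ofReal (hP.nonneg n u)]

theorem measureReal_window_eq_of_subset (hP : IsStationaryBlockLaw P) {ν : Measure (ℤ → E)}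
    [IsFiniteMeasure ν] {l : ℤ} {N : ℕ} (hν : ∀ u, ν.real (window l N ⁻¹' {u}) = P N u) {j : ℤ}
    {n : ℕ} (hl : l ≤ j) (hN : j + n ≤ l + N) (u : Fin n → E) :
    ν.real (window j n ⁻¹' {u}) = P n u := by
  obtain ⟨d, hd⟩ : ∃ d, n + d = N := ⟨N - n, by lia⟩
  induction d generalizing j n with
  | zero =>
    obtain rfl : n = N := hd
    obtain rfl : j = l := by lia
    exact hν u
  | succ d ih =>
    rcases hN.lt_or_eq with hlt | heq
    · rw [measureReal_window_eq_sum_snoc, ← hP.sum_snoc]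
      exact Finset.sum_congr rfl fun e _ => ih hl (by lia) _ (by lia)
    · obtain ⟨i, rfl⟩ : ∃ i, j = i + 1 := ⟨j - 1, by ring⟩
      rw [measureReal_window_eq_sum_cons, ← hP.sum_cons]
      exact Finset.sum_congr rfl fun e _ => ih (by lia) (by lia) _ (by lia)

theorem exists_invariantProb (hP : IsStationaryBlockLaw P) :
    ∃ M ∈ invariantProb (codeShift E), ∀ j n u, M.real (window j n ⁻¹' {u}) = P n u := by
  choose νs hνs using fun n : ℕ => hP.exists_probabilityMeasure_window (-(n : ℤ)) (2 * n)
  obtain ⟨ν, hν⟩ := exists_measure_of_eventually_window νs (P := P) fun j n u => by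
    filter_upwards [eventually_ge_atTop (j.natAbs + n)] with N hN
    exact hP.measureReal_window_eq_of_subset (hνs N) (by lia) (by lia) u
  refine ⟨ν, ⟨inferInstance, measurable_codeShift, ?_⟩, hν⟩
  have := Measure.isProbabilityMeasure_map (μ := (ν : Measure (ℤ → E)))
    (measurable_codeShift (E := E)).aemeasurable
  refine measure_ext_of_window fun j n u => ?_
  rw [map_measureReal_apply measurable_codeShift (measurableSet_preimage_window _ _),
    ← preimage_comp, show window j n ∘ codeShift E = window (j + 1) n from
      funext (window_codeShift j n), hν, hν]

end IsStationaryBlockLaw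

end WindowLaw

namespace MarkovSystem

variable {V E K : Type*} [Fintype E] [MeasurableSpace E] [MeasurableSpace K]
  {𝓜 : MarkovSystem V E K} {μ : Measure K}

/-- `M` is the law of the two-sided sequence of edges followed by the Markov system in equilibrium
with distribution `μ`. -/
def IsMarkovMeasure (𝓜 : MarkovSystem V E K) (μ : Measure K) (M : Measure (ℤ → E)) : Prop :=
  ∀ (j : ℤ) (n : ℕ) (u : Fin n → E), M.real (window j n ⁻¹' {u}) = 𝓜.blockProb μ u

theorem exists_isMarkovMeasure [DiscreteMeasurableSpace E] [IsProbabilityMeasure μ]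
    (h_inv : 𝓜.adjointOp μ = μ) :
    ∃ M ∈ invariantProb (codeShift E), 𝓜.IsMarkovMeasure μ M :=
  IsStationaryBlockLaw.exists_invariantProb
    { nonneg _ := 𝓜.blockProb_nonneg μ
      sum_eq_one := 𝓜.sum_blockProb μ
      sum_snoc _ := 𝓜.sum_blockProb_snoc μ
      sum_cons _ := sum_blockProb_cons h_inv }

namespace IsMarkovMeasure

variable {M : Measure (ℤ → E)}

theorem integral_window [DiscreteMeasurableSpace E] [IsFiniteMeasure μ] [IsFiniteMeasure M]
    (hM : 𝓜.IsMarkovMeasure μ M) (j : ℤ) {n : ℕ} (φ : (Fin n → E) → ℝ) :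
    ∫ σ, φ (window j n σ) ∂M = ∫ y, ∑ u, 𝓜.wordProb u y * φ u ∂μ := by
  rw [integral_comp_eq_sum (measurable_window j n),
    integral_finsetSum _ fun u _ => (integrable_wordProb u).mul_const _]
  simp only [hM j n, integral_mul_const, blockProb]

theorem ae_mem_pathSpace [IsFiniteMeasure M] (hM : 𝓜.IsMarkovMeasure μ M) :
    ∀ᵐ σ ∂M, σ ∈ 𝓜.pathSpace := by
  have blockProb_pos : ∀ᵐ σ ∂M, ∀ j : ℤ, 0 < 𝓜.blockProb μ (window j 2 σ) :=
    ae_all_iff.2 fun j => by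
      simpa only [hM j 2] using ae_measureReal_preimage_singleton_pos (μ := M) (window j 2)
  filter_upwards [blockProb_pos] with σ hσ j
  obtain ⟨y, hy⟩ : ∃ y, 𝓜.wordProb (window j 2 σ) y ≠ 0 := by
    by_contra! h
    exact (hσ j).ne' (by simp [blockProb, h])
  simp only [wordProb, window, mul_one, Fin.tail] at hy
  simpa using 𝓜.eq_of_mem_vertexSet
    (𝓜.w_mapsTo _ (𝓜.mem_of_p_ne_zero (left_ne_zero_of_mul hy)))
    (𝓜.mem_of_p_ne_zero (right_ne_zero_of_mul hy))

end IsMarkovMeasure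

end MarkovSystem

/-! ### The coding map -/

namespace MarkovSystem

section Coding

variable {V E K : Type*} [Fintype E] [MeasurableSpace K] (𝓜 : MarkovSystem V E K)

/-- The end point of the word `u` started at the reference point of its initial vertex. -/
def wordEnd (x : V → K) {n : ℕ} (u : Fin (n + 1) → E) : K := 𝓜.wordMap u (x (𝓜.ini (u 0)))

theorem backComp_eq_wordMap (σ : ℤ → E) (n : ℕ) (y : K) :
    𝓜.backComp σ n y = 𝓜.wordMap (window (-(n : ℤ)) (n + 1) σ) y := by
  induction n generalizing y with
  | zero => simp [backComp, wordMap, window]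
  | succ n ih =>
    have succ_start : -((n + 1 : ℕ) : ℤ) + 1 = -(n : ℤ) := by push_cast; ring
    rw [window_succ_eq_cons, wordMap_cons, succ_start, ← ih]
    simp [backComp]

theorem codingApprox_eq_wordEnd (x : V → K) (σ : ℤ → E) (n : ℕ) :
    𝓜.codingApprox x σ n = 𝓜.wordEnd x (window (-(n : ℤ)) (n + 1) σ) := by
  simp [codingApprox, backComp_eq_wordMap, wordEnd, window]

theorem codingApprox_codeShift (x : V → K) (σ : ℤ → E) (n : ℕ) :
    𝓜.codingApprox x (codeShift E σ) (n + 1) = 𝓜.w (σ 1) (𝓜.codingApprox x σ n) := by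
  have start : -((n + 1 : ℕ) : ℤ) + 1 = -(n : ℤ) := by push_cast; ring
  have last : -(n : ℤ) + (n + 1 : ℕ) = 1 := by push_cast; ring
  rw [codingApprox_eq_wordEnd, codingApprox_eq_wordEnd, window_codeShift, start,
    window_succ_eq_snoc, last, wordEnd, wordMap_snoc, wordEnd]
  rfl

theorem codingApprox_mem {x : V → K} (hx : ∀ v, x v ∈ 𝓜.vertexSet v) {σ : ℤ → E}
    (h : σ ∈ 𝓜.pathSpace) (n : ℕ) :
    𝓜.codingApprox x σ n ∈ 𝓜.vertexSet (𝓜.ini (σ 1)) := by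
  have backComp_mapsTo : MapsTo (𝓜.backComp σ n) (𝓜.vertexSet (𝓜.ini (σ (-(n : ℤ)))))
      (𝓜.vertexSet (𝓜.ini (σ 1))) := by
    induction n with
    | zero => simpa [backComp, h 0] using 𝓜.w_mapsTo (σ 0)
    | succ n ih =>
      have step := 𝓜.w_mapsTo (σ (-((n : ℤ) + 1)))
      rw [h, neg_add, neg_add_cancel_right, ← neg_add] at step
      simpa only [backComp, Nat.cast_succ] using ih.comp step
  exact backComp_mapsTo (hx _)

theorem measurable_codingApprox [MeasurableSpace E] [DiscreteMeasurableSpace E] (x : V → K)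
    (n : ℕ) : Measurable fun σ => 𝓜.codingApprox x σ n := by
  simp only [codingApprox_eq_wordEnd]
  exact (measurable_of_finite (𝓜.wordEnd x)).comp (measurable_window _ _)

theorem measurableSet_pathSpace [MeasurableSpace E] [DiscreteMeasurableSpace E] :
    MeasurableSet 𝓜.pathSpace := by
  have : 𝓜.pathSpace =
      ⋂ j : ℤ, (fun σ : ℤ → E => (σ j, σ (j + 1))) ⁻¹' {e | 𝓜.ter e.1 = 𝓜.ini e.2} := by
    ext σ
    simp [pathSpace]
  rw [this]
  exact MeasurableSet.iInter fun j =>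
    ((measurable_pi_apply j).prodMk (measurable_pi_apply (j + 1))) (toFinite _).measurableSet

section Topology

variable [TopologicalSpace K] {x : V → K} {σ : ℤ → E}

theorem mem_codingCore_iff :
    σ ∈ 𝓜.codingCore x ↔
      ∀ j : ℤ, (codeShift E ^ j : Equiv.Perm (ℤ → E)) σ ∈ 𝓜.codingDomain x := by
  simp only [codingCore, mem_iInter, Equiv.image_eq_preimage_symm, mem_preimage]
  exact (Equiv.neg ℤ).forall_congr fun {j} => by rw [Equiv.neg_apply, zpow_neg]; rfl

theorem codingCore_subset_codingDomain : 𝓜.codingCore x ⊆ 𝓜.codingDomain x := fun _ hσ => by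
  simpa using 𝓜.mem_codingCore_iff.1 hσ 0

theorem codeShift_mem_codingCore (h : σ ∈ 𝓜.codingCore x) : codeShift E σ ∈ 𝓜.codingCore x :=
  𝓜.mem_codingCore_iff.2 fun j => by
    rw [← Equiv.Perm.mul_apply, ← zpow_add_one]
    exact 𝓜.mem_codingCore_iff.1 h (j + 1)

theorem tendsto_codingMap (h : σ ∈ 𝓜.codingDomain x) :
    Tendsto (𝓜.codingApprox x σ) atTop (𝓝 (𝓜.codingMap x σ)) := by
  rw [codingMap, dif_pos h.2]
  exact h.2.choose_spec

theorem isClosed_vertexSet (h_open : ∀ v, IsOpen (𝓜.vertexSet v)) (v : V) :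
    IsClosed (𝓜.vertexSet v) := by
  have compl_eq : (𝓜.vertexSet v)ᶜ = ⋃ v' ∈ ({v}ᶜ : Set V), 𝓜.vertexSet v' := by
    ext y
    obtain ⟨v', hv'⟩ := 𝓜.exists_mem_vertexSet y
    simp only [mem_compl_iff, mem_iUnion, mem_singleton_iff, exists_prop]
    exact ⟨fun hy => ⟨v', fun he => hy (he ▸ hv'), hv'⟩,
      fun ⟨_, hne, hy'⟩ hy => hne (𝓜.eq_of_mem_vertexSet hy' hy)⟩
  rw [← isOpen_compl_iff, compl_eq]
  exact isOpen_biUnion fun v' _ => h_open v'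

theorem codingMap_mem (h_open : ∀ v, IsOpen (𝓜.vertexSet v)) (hx : ∀ v, x v ∈ 𝓜.vertexSet v)
    (h : σ ∈ 𝓜.codingDomain x) : 𝓜.codingMap x σ ∈ 𝓜.vertexSet (𝓜.ini (σ 1)) :=
  (𝓜.isClosed_vertexSet h_open _).mem_of_tendsto (𝓜.tendsto_codingMap h)
    (Eventually.of_forall fun n => 𝓜.codingApprox_mem hx h.1 n)

theorem codingMap_codeShift [T2Space K] (h_open : ∀ v, IsOpen (𝓜.vertexSet v))
    (hw : ∀ e, ContinuousOn (𝓜.w e) (𝓜.vertexSet (𝓜.ini e))) (hx : ∀ v, x v ∈ 𝓜.vertexSet v)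
    (h : σ ∈ 𝓜.codingCore x) :
    𝓜.codingMap x (codeShift E σ) = 𝓜.w (σ 1) (𝓜.codingMap x σ) := by
  have hD := 𝓜.codingCore_subset_codingDomain h
  have shifted_limit := (tendsto_add_atTop_iff_nat 1).2 (𝓜.tendsto_codingMap
    (𝓜.codingCore_subset_codingDomain (𝓜.codeShift_mem_codingCore h)))
  simp only [codingApprox_codeShift] at shifted_limit
  have w_continuousAt : ContinuousAt (𝓜.w (σ 1)) (𝓜.codingMap x σ) :=
    (hw _).continuousAt ((h_open _).mem_nhds (𝓜.codingMap_mem h_open hx hD))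
  exact tendsto_nhds_unique shifted_limit (w_continuousAt.tendsto.comp (𝓜.tendsto_codingMap hD))

theorem continuous_markovOp (h_open : ∀ v, IsOpen (𝓜.vertexSet v))
    (hw : ∀ e, ContinuousOn (𝓜.w e) (𝓜.vertexSet (𝓜.ini e)))
    (hp : ∀ e, ContinuousOn (𝓜.p e) (𝓜.vertexSet (𝓜.ini e))) {f : K → ℝ} (hf : Continuous f) :
    Continuous (𝓜.markovOp f) := by
  refine continuous_finsetSum _ fun e _ => continuous_iff_continuousAt.2 fun y => ?_
  by_cases hy : y ∈ 𝓜.vertexSet (𝓜.ini e)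
  · have hn := (h_open _).mem_nhds hy
    exact ((hp e).continuousAt hn).mul (hf.continuousAt.comp ((hw e).continuousAt hn))
  · have hn := (𝓜.isClosed_vertexSet h_open (𝓜.ini e)).isOpen_compl.mem_nhds hy
    refine ContinuousAt.congr (f := fun _ => (0 : ℝ)) continuousAt_const ?_
    filter_upwards [hn] with z hz
    rw [𝓜.p_zero e z hz, zero_mul]

end Topology

theorem measurableSet_codingCore {K : Type*} [PseudoEMetricSpace K] [CompleteSpace K]
    [SecondCountableTopology K] [MeasurableSpace K] [BorelSpace K] [MeasurableSpace E]
    [DiscreteMeasurableSpace E] (𝓜 : MarkovSystem V E K) (x : V → K) :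
    MeasurableSet (𝓜.codingCore x) := by
  have domain_meas : MeasurableSet (𝓜.codingDomain x) :=
    𝓜.measurableSet_pathSpace.inter
      (measurableSet_exists_tendsto fun n => 𝓜.measurable_codingApprox x n)
  have core_eq : 𝓜.codingCore x =
      ⋂ j : ℤ, (codeShift E ^ j : Equiv.Perm (ℤ → E)) ⁻¹' 𝓜.codingDomain x := by
    ext σ
    simp [mem_codingCore_iff]
  rw [core_eq]
  exact MeasurableSet.iInter fun j => measurable_codeShift_zpow j domain_meas

end Coding

theorem continuousOn_w {V E K : Type*} [Fintype E] [PseudoMetricSpace K] [MeasurableSpace K]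
    {𝓜 : MarkovSystem V E K} {a δ : ℝ} (h_contr : 𝓜.IsContractive a) (hδ : 0 < δ)
    (h_pos : ∀ e, ∀ y ∈ 𝓜.vertexSet (𝓜.ini e), δ ≤ 𝓜.p e y) (e : E) :
    ContinuousOn (𝓜.w e) (𝓜.vertexSet (𝓜.ini e)) := by
  obtain ⟨a_pos, -, contracts⟩ := h_contr
  refine (LipschitzOnWith.of_dist_le_mul (K := (a / δ).toNNReal)
    fun y hy z hz => ?_).continuousOn
  rw [Real.coe_toNNReal _ (div_nonneg a_pos.le hδ.le), div_mul_eq_mul_div, le_div_iff₀' hδ]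
  calc δ * dist (𝓜.w e y) (𝓜.w e z) ≤ 𝓜.p e y * dist (𝓜.w e y) (𝓜.w e z) :=
        mul_le_mul_of_nonneg_right (h_pos e y hy) dist_nonneg
    _ ≤ ∑ e, 𝓜.p e y * dist (𝓜.w e y) (𝓜.w e z) :=
        Finset.single_le_sum (f := fun e => 𝓜.p e y * dist (𝓜.w e y) (𝓜.w e z))
          (fun e _ => mul_nonneg (𝓜.p_nonneg e y) dist_nonneg) (Finset.mem_univ e)
    _ ≤ a * dist y z := contracts _ y hy z hz

end MarkovSystem

/-! ### First moments and the domain of the coding map -/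

section TruncatedMeans

variable {X : Type*} [MeasurableSpace X] {μ : Measure X}

theorem integrable_of_tendsto_of_integral_le {g : ℕ → X → ℝ} {f : X → ℝ} {b : ℝ}
    (hg : ∀ n, Integrable (g n) μ) (hg_nonneg : ∀ n x, 0 ≤ g n x) (hb : ∀ n, ∫ x, g n x ∂μ ≤ b)
    (h : ∀ x, Tendsto (fun n => g n x) atTop (𝓝 (f x))) : Integrable f μ := by
  refine ⟨aestronglyMeasurable_of_tendsto_ae _ (fun n => (hg n).1) (ae_of_all _ h), ?_⟩
  calc ∫⁻ x, ‖f x‖ₑ ∂μ = ∫⁻ x, liminf (fun n => ‖g n x‖ₑ) atTop ∂μ :=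
        lintegral_congr fun x => (h x).enorm.liminf_eq.symm
    _ ≤ liminf (fun n => ∫⁻ x, ‖g n x‖ₑ ∂μ) atTop :=
        lintegral_liminf_le' fun n => (hg n).1.enorm
    _ ≤ liminf (fun _ => ENNReal.ofReal b) atTop := by
        refine liminf_le_liminf (Eventually.of_forall fun n => ?_)
        rw [← ofReal_integral_norm_eq_lintegral_enorm (hg n)]
        simpa only [Real.norm_of_nonneg (hg_nonneg n _)] using ENNReal.ofReal_le_ofReal (hb n)
    _ < ⊤ := by simp

theorem integrable_min_const [IsFiniteMeasure μ] {f : X → ℝ} (hf : Measurable f)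
    (hf_nonneg : ∀ x, 0 ≤ f x) {c : ℝ} (hc : 0 ≤ c) : Integrable (fun x => min (f x) c) μ :=
  .of_bound (hf.min measurable_const).aestronglyMeasurable c (ae_of_all _ fun x => by
    rw [Real.norm_of_nonneg (le_min (hf_nonneg x) hc)]
    exact min_le_right _ _)

theorem integrable_of_integral_min_le [IsProbabilityMeasure μ] {f : X → ℝ} (hf : Measurable f)
    (hf_nonneg : ∀ x, 0 ≤ f x) {a b : ℝ} (ha_nonneg : 0 ≤ a) (ha : a < 1) (hb : 0 ≤ b)
    (h : ∀ n : ℕ, ∫ x, min (f x) n ∂μ ≤ ∫ x, min (a * f x + b) n ∂μ) : Integrable f μ := by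
  have f_int (n : ℕ) : Integrable (fun x => min (f x) (n : ℝ)) μ :=
    integrable_min_const hf hf_nonneg n.cast_nonneg
  have drift_int (n : ℕ) : Integrable (fun x => min (a * f x + b) (n : ℝ)) μ :=
    integrable_min_const ((hf.const_mul a).add_const b)
      (fun x => add_nonneg (mul_nonneg ha_nonneg (hf_nonneg x)) hb) n.cast_nonneg
  have sub_int (n : ℕ) : Integrable (fun x => min (f x) (n : ℝ) - min (a * f x + b) n) μ :=
    (f_int n).sub (drift_int n)
  set g : ℕ → X → ℝ := fun n x => min (f x) n - min (a * f x + b) n + b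
  have g_int (n : ℕ) : Integrable (g n) μ :=
    (sub_int n).add (integrable_const b)
  have g_nonneg (n : ℕ) (x : X) : 0 ≤ g n x := by
    have : min (a * f x + b) (n : ℝ) ≤ min (f x) n + b := by
      rw [← min_add_add_right]
      exact min_le_min (by gcongr; exact mul_le_of_le_one_left (hf_nonneg x) ha.le) (by linarith)
    linarith [this]
  have g_integral (n : ℕ) : ∫ x, g n x ∂μ ≤ b := by
    calc ∫ x, g n x ∂μ
        = ∫ x, min (f x) (n : ℝ) ∂μ - ∫ x, min (a * f x + b) (n : ℝ) ∂μ + b := by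
          simp only [g]
          rw [integral_add (sub_int n) (integrable_const b), integral_sub (f_int n) (drift_int n)]
          simp
      _ ≤ b := by linarith [h n]
  have g_tendsto (x : X) : Tendsto (fun n => g n x) atTop (𝓝 ((1 - a) * f x)) := by
    refine tendsto_const_nhds.congr' ?_
    filter_upwards [tendsto_natCast_atTop_atTop.eventually_ge_atTop (f x),
      tendsto_natCast_atTop_atTop.eventually_ge_atTop (a * f x + b)] with n hn hn'
    simp only [g, min_eq_left hn, min_eq_left hn']
    ring
  exact (integrable_const_mul_iff (sub_pos.2 ha).ne'.isUnit f).1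
    (integrable_of_tendsto_of_integral_le g_int g_nonneg g_integral g_tendsto)

end TruncatedMeans

namespace MarkovSystem

section Drift

variable {V E K : Type*} [Fintype E] [MeasurableSpace K] {𝓜 : MarkovSystem V E K}

theorem markovOp_mono {f g : K → ℝ} (h : ∀ y, f y ≤ g y) (y : K) :
    𝓜.markovOp f y ≤ 𝓜.markovOp g y :=
  Finset.sum_le_sum fun e _ => mul_le_mul_of_nonneg_left (h _) (𝓜.p_nonneg e y)

/-- The Foster–Lyapunov criterion. -/
theorem integrable_of_markovOp_le {μ : Measure K} [IsProbabilityMeasure μ]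
    (h_inv : 𝓜.adjointOp μ = μ) {f : K → ℝ} (hf : Measurable f) (hf_nonneg : ∀ y, 0 ≤ f y)
    {a b : ℝ} (ha_nonneg : 0 ≤ a) (ha : a < 1) (hb : 0 ≤ b)
    (h : ∀ y, 𝓜.markovOp f y ≤ a * f y + b) : Integrable f μ := by
  refine integrable_of_integral_min_le hf hf_nonneg ha_nonneg ha hb fun n => ?_
  have min_meas : Measurable fun y => min (f y) (n : ℝ) := hf.min measurable_const
  have min_bdd (y : K) : |min (f y) (n : ℝ)| ≤ n := by
    rw [abs_of_nonneg (le_min (hf_nonneg y) n.cast_nonneg)]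
    exact min_le_right _ _
  rw [← integral_markovOp h_inv min_meas min_bdd]
  refine integral_mono
    (.of_bound (𝓜.measurable_markovOp min_meas).aestronglyMeasurable n
      (ae_of_all _ (𝓜.abs_markovOp_le min_bdd)))
    (integrable_min_const ((hf.const_mul a).add_const b)
      (fun y => add_nonneg (mul_nonneg ha_nonneg (hf_nonneg y)) hb) n.cast_nonneg)
    fun y => le_min ((markovOp_mono (fun z => min_le_left _ _) y).trans (h y))
      ((le_abs_self _).trans (𝓜.abs_markovOp_le min_bdd y))

end Drift

/-- The total distance by which the maps displace the reference points `x v`. -/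
noncomputable def driftConst {V E K : Type*} [Fintype E] [PseudoMetricSpace K] [MeasurableSpace K]
    (𝓜 : MarkovSystem V E K) (x : V → K) : ℝ :=
  ∑ e, dist (𝓜.w e (x (𝓜.ini e))) (x (𝓜.ter e))

section CellDist

variable {V E K : Type*} [Fintype E] [PseudoMetricSpace K] [MeasurableSpace K]

/-- The distance from `y` to the reference point `x v` of the vertex set containing `y`. -/
noncomputable def cellDist (𝓜 : MarkovSystem V E K) (x : V → K) (y : K) : ℝ :=
  dist y (x (𝓜.exists_mem_vertexSet y).choose)

variable {𝓜 : MarkovSystem V E K} {x : V → K} {a : ℝ}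

theorem cellDist_eq (x : V → K) {v : V} {y : K} (hy : y ∈ 𝓜.vertexSet v) :
    𝓜.cellDist x y = dist y (x v) := by
  rw [cellDist, 𝓜.eq_of_mem_vertexSet (𝓜.exists_mem_vertexSet y).choose_spec hy]

theorem cellDist_nonneg (x : V → K) (y : K) : 0 ≤ 𝓜.cellDist x y := dist_nonneg

theorem measurable_cellDist [OpensMeasurableSpace K] (x : V → K) : Measurable (𝓜.cellDist x) := by
  have : Finite V := .of_surjective _ 𝓜.ini_surjective
  intro s hs
  have preimage_eq :
      𝓜.cellDist x ⁻¹' s = ⋃ v, 𝓜.vertexSet v ∩ (fun y => dist y (x v)) ⁻¹' s := by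
    ext y
    obtain ⟨v, hv⟩ := 𝓜.exists_mem_vertexSet y
    simp only [mem_preimage, mem_iUnion, mem_inter_iff]
    exact ⟨fun hy => ⟨v, hv, by rwa [← cellDist_eq x hv]⟩,
      fun ⟨v', hv', hy⟩ => by rwa [cellDist_eq x hv']⟩
  rw [preimage_eq]
  exact .iUnion fun v => (𝓜.vertexSet_measurable v).inter
    ((continuous_id.dist continuous_const).measurable hs)

theorem markovOp_cellDist_le (h_contr : 𝓜.IsContractive a) (hx : ∀ v, x v ∈ 𝓜.vertexSet v)
    (y : K) : 𝓜.markovOp (𝓜.cellDist x) y ≤ a * 𝓜.cellDist x y + 𝓜.driftConst x := by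
  obtain ⟨v, hv⟩ := 𝓜.exists_mem_vertexSet y
  calc 𝓜.markovOp (𝓜.cellDist x) y
      ≤ ∑ e, (𝓜.p e y * dist (𝓜.w e y) (𝓜.w e (x v)) + 𝓜.p e y * 𝓜.driftConst x) := by
        refine Finset.sum_le_sum fun e _ => ?_
        rcases eq_or_ne (𝓜.p e y) 0 with he | he
        · simp [he]
        have hi := 𝓜.mem_of_p_ne_zero he
        obtain rfl := 𝓜.eq_of_mem_vertexSet hv hi
        rw [← mul_add, cellDist_eq x (𝓜.w_mapsTo e hi)]
        refine mul_le_mul_of_nonneg_left ((dist_triangle _ (𝓜.w e (x (𝓜.ini e))) _).trans ?_)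
          (𝓜.p_nonneg e y)
        gcongr
        exact Finset.single_le_sum (f := fun e => dist (𝓜.w e (x (𝓜.ini e))) (x (𝓜.ter e)))
          (fun _ _ => dist_nonneg) (Finset.mem_univ e)
    _ = ∑ e, 𝓜.p e y * dist (𝓜.w e y) (𝓜.w e (x v)) + 𝓜.driftConst x := by
        rw [Finset.sum_add_distrib, ← Finset.sum_mul, 𝓜.p_sum, one_mul]
    _ ≤ a * 𝓜.cellDist x y + 𝓜.driftConst x := by
        rw [cellDist_eq x hv]
        gcongr
        exact h_contr.2.2 v y hv _ (hx v)

theorem integrable_cellDist [OpensMeasurableSpace K] (h_contr : 𝓜.IsContractive a)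
    (hx : ∀ v, x v ∈ 𝓜.vertexSet v) {μ : Measure K} [IsProbabilityMeasure μ]
    (h_inv : 𝓜.adjointOp μ = μ) : Integrable (𝓜.cellDist x) μ :=
  integrable_of_markovOp_le h_inv (measurable_cellDist x) (cellDist_nonneg x) h_contr.1.le
    h_contr.2.1 (Finset.sum_nonneg fun _ _ => dist_nonneg) (markovOp_cellDist_le h_contr hx)

theorem sum_wordProb_dist_wordEnd_le (h_contr : 𝓜.IsContractive a)
    (hx : ∀ v, x v ∈ 𝓜.vertexSet v) (n : ℕ) (y : K) :
    ∑ u : Fin (n + 1) → E, 𝓜.wordProb u y * dist (𝓜.wordMap u y) (𝓜.wordEnd x u) ≤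
      a ^ (n + 1) * 𝓜.cellDist x y := by
  obtain ⟨v, hv⟩ := 𝓜.exists_mem_vertexSet y
  rw [cellDist_eq x hv]
  refine le_trans (le_of_eq ?_) (sum_wordProb_dist_le h_contr (n + 1) ⟨v, hv, hx v⟩)
  refine Finset.sum_congr rfl fun u _ => ?_
  rcases eq_or_ne (𝓜.wordProb u y) 0 with hu | hu
  · simp [hu]
  · rw [wordEnd, 𝓜.eq_of_mem_vertexSet (𝓜.mem_of_p_ne_zero (left_ne_zero_of_mul hu)) hv]

theorem sum_wordProb_dist_wordEnd_tail_le (h_contr : 𝓜.IsContractive a)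
    (hx : ∀ v, x v ∈ 𝓜.vertexSet v) (n : ℕ) (y : K) :
    ∑ u : Fin (n + 2) → E, 𝓜.wordProb u y * dist (𝓜.wordEnd x (Fin.tail u)) (𝓜.wordEnd x u) ≤
      a ^ (n + 1) * (2 * 𝓜.cellDist x y + 𝓜.driftConst x) := by
  have pow_nonneg : 0 ≤ a ^ (n + 1) := pow_nonneg h_contr.1.le _
  have cellDist_contracts : a * 𝓜.cellDist x y ≤ 𝓜.cellDist x y :=
    mul_le_of_le_one_left (cellDist_nonneg x y) h_contr.2.1.le
  calc _ ≤ ∑ u : Fin (n + 2) → E,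
        (𝓜.wordProb u y * dist (𝓜.wordMap u y) (𝓜.wordEnd x (Fin.tail u)) +
          𝓜.wordProb u y * dist (𝓜.wordMap u y) (𝓜.wordEnd x u)) := by
        refine Finset.sum_le_sum fun u _ => ?_
        rw [← mul_add]
        exact mul_le_mul_of_nonneg_left (dist_triangle_left _ _ _) (𝓜.wordProb_nonneg u y)
    _ = ∑ e, 𝓜.p e y * ∑ u : Fin (n + 1) → E, 𝓜.wordProb u (𝓜.w e y) *
          dist (𝓜.wordMap u (𝓜.w e y)) (𝓜.wordEnd x u) +
        ∑ u : Fin (n + 2) → E, 𝓜.wordProb u y * dist (𝓜.wordMap u y) (𝓜.wordEnd x u) := by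
        rw [Finset.sum_add_distrib, sum_wordProb_succ]
        simp only [wordMap_cons, Fin.tail_cons]
    _ ≤ ∑ e, 𝓜.p e y * (a ^ (n + 1) * 𝓜.cellDist x (𝓜.w e y)) +
        a ^ (n + 2) * 𝓜.cellDist x y :=
        add_le_add (Finset.sum_le_sum fun e _ => mul_le_mul_of_nonneg_left
          (sum_wordProb_dist_wordEnd_le h_contr hx n _) (𝓜.p_nonneg e y))
          (sum_wordProb_dist_wordEnd_le h_contr hx (n + 1) y)
    _ = a ^ (n + 1) * (𝓜.markovOp (𝓜.cellDist x) y + a * 𝓜.cellDist x y) := by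
        simp only [markovOp, mul_left_comm, ← Finset.mul_sum]
        ring
    _ ≤ a ^ (n + 1) * (2 * 𝓜.cellDist x y + 𝓜.driftConst x) := by
        refine mul_le_mul_of_nonneg_left ?_ pow_nonneg
        linarith [markovOp_cellDist_le h_contr hx y]

end CellDist

theorem codingApprox_eq_wordEnd_tail {V E K : Type*} [Fintype E] [MeasurableSpace K]
    (𝓜 : MarkovSystem V E K) (x : V → K) (σ : ℤ → E) (n : ℕ) :
    𝓜.codingApprox x σ n =
      𝓜.wordEnd x (Fin.tail (window (-((n + 1 : ℕ) : ℤ)) (n + 2) σ)) := by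
  have start : -((n + 1 : ℕ) : ℤ) + 1 = -(n : ℤ) := by push_cast; ring
  rw [window_succ_eq_cons (-((n + 1 : ℕ) : ℤ)) (n + 1), Fin.tail_cons, start,
    codingApprox_eq_wordEnd]

namespace IsMarkovMeasure

variable {V E K : Type*} [Fintype E] [MeasurableSpace E] [DiscreteMeasurableSpace E]
  [PseudoMetricSpace K] [MeasurableSpace K] {𝓜 : MarkovSystem V E K}
  {μ : Measure K} [IsProbabilityMeasure μ] {M : Measure (ℤ → E)} {a : ℝ} {x : V → K}

theorem lintegral_edist_codingApprox_le [OpensMeasurableSpace K] [IsFiniteMeasure M]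
    (hM : 𝓜.IsMarkovMeasure μ M) (h_inv : 𝓜.adjointOp μ = μ) (h_contr : 𝓜.IsContractive a)
    (hx : ∀ v, x v ∈ 𝓜.vertexSet v) (n : ℕ) :
    ∫⁻ σ, edist (𝓜.codingApprox x σ n) (𝓜.codingApprox x σ (n + 1)) ∂M ≤
      ENNReal.ofReal (a ^ (n + 1) * ∫ y, (2 * 𝓜.cellDist x y + 𝓜.driftConst x) ∂μ) := by
  simp only [codingApprox_eq_wordEnd_tail 𝓜 x _ n, codingApprox_eq_wordEnd 𝓜 x _ (n + 1),
    edist_dist]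
  set φ : (Fin (n + 2) → E) → ℝ := fun u => dist (𝓜.wordEnd x (Fin.tail u)) (𝓜.wordEnd x u)
  rw [← ofReal_integral_eq_lintegral_ofReal (f := fun σ => φ (window _ (n + 2) σ))
    ((Integrable.of_finite (f := φ)).comp_measurable (measurable_window _ _))
    (ae_of_all _ fun _ => dist_nonneg), hM.integral_window, ← integral_const_mul]
  exact ENNReal.ofReal_le_ofReal (integral_mono
    (integrable_finsetSum _ fun u _ => (integrable_wordProb u).mul_const _)
    ((((integrable_cellDist h_contr hx h_inv).const_mul 2).add
      (integrable_const _)).const_mul _)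
    (sum_wordProb_dist_wordEnd_tail_le h_contr hx n))

theorem ae_exists_tendsto_codingApprox [OpensMeasurableSpace K] [SecondCountableTopology K]
    [CompleteSpace K] [IsFiniteMeasure M] (hM : 𝓜.IsMarkovMeasure μ M)
    (h_inv : 𝓜.adjointOp μ = μ) (h_contr : 𝓜.IsContractive a) (hx : ∀ v, x v ∈ 𝓜.vertexSet v) :
    ∀ᵐ σ ∂M, ∃ z, Tendsto (𝓜.codingApprox x σ) atTop (𝓝 z) := by
  have edist_meas (n : ℕ) : Measurable fun σ =>
      edist (𝓜.codingApprox x σ n) (𝓜.codingApprox x σ (n + 1)) :=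
    (𝓜.measurable_codingApprox x n).edist (𝓜.measurable_codingApprox x (n + 1))
  have lintegral_ne_top :
      ∫⁻ σ, ∑' n, edist (𝓜.codingApprox x σ n) (𝓜.codingApprox x σ (n + 1)) ∂M ≠ ⊤ := by
    rw [lintegral_tsum fun n => (edist_meas n).aemeasurable]
    have geometric := ((summable_nat_add_iff 1).2
      (summable_geometric_of_lt_one h_contr.1.le h_contr.2.1)).mul_right
        (∫ y, (2 * 𝓜.cellDist x y + 𝓜.driftConst x) ∂μ)
    exact ne_top_of_le_ne_top geometric.tsum_ofReal_ne_top
      (ENNReal.tsum_le_tsum (hM.lintegral_edist_codingApprox_le h_inv h_contr hx))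
  filter_upwards [ae_lt_top (Measurable.tsum edist_meas) lintegral_ne_top] with σ hσ
  exact cauchySeq_tendsto_of_complete
    (cauchySeq_of_edist_le_of_tsum_ne_top _ (fun _ => le_rfl) hσ.ne)

theorem ae_mem_codingCore [OpensMeasurableSpace K] [SecondCountableTopology K] [CompleteSpace K]
    (hM : 𝓜.IsMarkovMeasure μ M) (hM_inv : M ∈ invariantProb (codeShift E))
    (h_inv : 𝓜.adjointOp μ = μ) (h_contr : 𝓜.IsContractive a) (hx : ∀ v, x v ∈ 𝓜.vertexSet v) :
    ∀ᵐ σ ∂M, σ ∈ 𝓜.codingCore x := by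
  have := hM_inv.1
  simp only [mem_codingCore_iff]
  exact ae_all_iff.2 fun j => (measurePreserving_codeShift_zpow hM_inv j).quasiMeasurePreserving.ae
    (hM.ae_mem_pathSpace.and (hM.ae_exists_tendsto_codingApprox h_inv h_contr hx))

end IsMarkovMeasure

end MarkovSystem

/-! ### Integrals along the coding map -/

theorem ext_of_forall_lipschitz_integral_eq {X : Type*} [PseudoEMetricSpace X] [MeasurableSpace X]
    [BorelSpace X] {μ ν : Measure X} [IsFiniteMeasure μ] [IsFiniteMeasure ν]
    (h : ∀ f : X → ℝ, (∀ y, |f y| ≤ 1) → (∃ L, LipschitzWith L f) → ∫ y, f y ∂μ = ∫ y, f y ∂ν) :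
    μ = ν := by
  refine ext_of_generate_finite _ (by rw [BorelSpace.measurable_eq (α := X),
    borel_eq_generateFrom_isClosed]) isPiSystem_isClosed (fun s hs => ?_) ?_
  · have radius_pos (n : ℕ) : 0 < 1 / ((n : ℝ) + 1) := by positivity
    have tendsto_real (ρ : Measure X) [IsFiniteMeasure ρ] :=
      tendsto_integral_thickenedIndicator_of_isClosed ρ hs radius_pos
        tendsto_one_div_add_atTop_nhds_zero_nat
    refine (measureReal_eq_measureReal_iff).1 (tendsto_nhds_unique (tendsto_real μ) ?_)
    refine (tendsto_real ν).congr fun n => (h _ (fun y => ?_)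
      ⟨_, lipschitzWith_thickenedIndicator (radius_pos n) s⟩).symm
    exact (abs_of_nonneg (NNReal.coe_nonneg _)).trans_le
      (mod_cast thickenedIndicator_le_one (radius_pos n) s y)
  · simpa [measureReal_eq_measureReal_iff] using h 1 (by simp) ⟨0, LipschitzWith.const 1⟩

namespace MarkovSystem

section Integrals

variable {V E K : Type*} [Fintype E] [MeasurableSpace E] [DiscreteMeasurableSpace E]
  [MeasurableSpace K] {𝓜 : MarkovSystem V E K} {x : V → K} {ν : Measure (ℤ → E)} {g : E → K → ℝ}

theorem measurable_comp_codingApprox (hg : ∀ e, Measurable (g e)) (n : ℕ) :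
    Measurable fun σ => g (σ 1) (𝓜.codingApprox x σ n) :=
  (measurable_from_prod_countable_right hg : Measurable fun z : E × K => g z.1 z.2).comp
    ((measurable_pi_apply 1).prodMk (𝓜.measurable_codingApprox x n))

variable [PseudoMetricSpace K]

theorem tendsto_integral_codingApprox [IsFiniteMeasure ν] (h_open : ∀ v, IsOpen (𝓜.vertexSet v))
    (hx : ∀ v, x v ∈ 𝓜.vertexSet v) (hν : ∀ᵐ σ ∂ν, σ ∈ 𝓜.codingCore x)
    (hg : ∀ e, Measurable (g e)) (hg_cont : ∀ e, ContinuousOn (g e) (𝓜.vertexSet (𝓜.ini e)))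
    {C : ℝ} (hC : ∀ e, ∀ y ∈ 𝓜.vertexSet (𝓜.ini e), |g e y| ≤ C) :
    Tendsto (fun n => ∫ σ, g (σ 1) (𝓜.codingApprox x σ n) ∂ν) atTop
      (𝓝 (∫ σ, g (σ 1) (𝓜.codingMap x σ) ∂ν)) := by
  refine tendsto_integral_of_dominated_convergence (fun _ => C)
    (fun n => (measurable_comp_codingApprox hg n).aestronglyMeasurable) (integrable_const _)
    (fun n => ?_) ?_
  · filter_upwards [hν] with σ hσ
    exact hC _ _ (𝓜.codingApprox_mem hx (𝓜.codingCore_subset_codingDomain hσ).1 n)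
  · filter_upwards [hν] with σ hσ
    have hD := 𝓜.codingCore_subset_codingDomain hσ
    exact ((hg_cont _).continuousAt ((h_open _).mem_nhds
      (𝓜.codingMap_mem h_open hx hD))).tendsto.comp (𝓜.tendsto_codingMap hD)

variable [BorelSpace K]

theorem aemeasurable_codingMap (hν : ∀ᵐ σ ∂ν, σ ∈ 𝓜.codingCore x) :
    AEMeasurable (𝓜.codingMap x) ν :=
  aemeasurable_of_tendsto_metrizable_ae atTop
    (fun n => (𝓜.measurable_codingApprox x n).aemeasurable)
    (hν.mono fun _ hσ => 𝓜.tendsto_codingMap (𝓜.codingCore_subset_codingDomain hσ))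

theorem aemeasurable_comp_codingMap (hν : ∀ᵐ σ ∂ν, σ ∈ 𝓜.codingCore x)
    (hg : ∀ e, Measurable (g e)) : AEMeasurable (fun σ => g (σ 1) (𝓜.codingMap x σ)) ν :=
  have hg' : Measurable fun z : E × K => g z.1 z.2 := measurable_from_prod_countable_right hg
  hg'.comp_aemeasurable ((measurable_pi_apply 1).aemeasurable.prodMk (aemeasurable_codingMap hν))

end Integrals

theorem abs_sum_wordProb_mul_sub_le {V E K : Type*} [Fintype E] [PseudoMetricSpace K]
    [MeasurableSpace K] {𝓜 : MarkovSystem V E K} {a : ℝ} (h_contr : 𝓜.IsContractive a) {x : V → K}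
    (hx : ∀ v, x v ∈ 𝓜.vertexSet v) {g : E → K → ℝ} {L : NNReal}
    (hL : ∀ e, LipschitzWith L (g e)) (n : ℕ) (y : K) :
    |∑ u : Fin (n + 1) → E, 𝓜.wordProb u y * ∑ e, 𝓜.p e (𝓜.wordMap u y) *
      (g e (𝓜.wordEnd x u) - g e (𝓜.wordMap u y))| ≤ L * (a ^ (n + 1) * 𝓜.cellDist x y) := by
  calc |∑ u : Fin (n + 1) → E, 𝓜.wordProb u y * ∑ e, 𝓜.p e (𝓜.wordMap u y) *
        (g e (𝓜.wordEnd x u) - g e (𝓜.wordMap u y))|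
      ≤ ∑ u : Fin (n + 1) → E,
          L * (𝓜.wordProb u y * dist (𝓜.wordMap u y) (𝓜.wordEnd x u)) := by
        refine (Finset.abs_sum_le_sum_abs _ _).trans (Finset.sum_le_sum fun u _ => ?_)
        rw [abs_mul, abs_of_nonneg (𝓜.wordProb_nonneg u y), mul_left_comm]
        refine mul_le_mul_of_nonneg_left (𝓜.abs_sum_p_mul_le (fun e => ?_) _)
          (𝓜.wordProb_nonneg u y)
        rw [dist_comm]
        exact (hL e).dist_le_mul _ _
    _ ≤ L * (a ^ (n + 1) * 𝓜.cellDist x y) := by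
        rw [← Finset.mul_sum]
        exact mul_le_mul_of_nonneg_left (sum_wordProb_dist_wordEnd_le h_contr hx n y) L.2

namespace IsMarkovMeasure

variable {V E K : Type*} [Fintype E] [MeasurableSpace E] [DiscreteMeasurableSpace E]
  [MeasurableSpace K] {𝓜 : MarkovSystem V E K} {μ : Measure K} [IsProbabilityMeasure μ]
  {M : Measure (ℤ → E)} [IsFiniteMeasure M] {a : ℝ} {x : V → K} {g : E → K → ℝ}

theorem integral_comp_codingApprox (hM : 𝓜.IsMarkovMeasure μ M) (n : ℕ) :
    ∫ σ, g (σ 1) (𝓜.codingApprox x σ n) ∂M =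
      ∫ y, ∑ u : Fin (n + 1) → E, 𝓜.wordProb u y *
        ∑ e, 𝓜.p e (𝓜.wordMap u y) * g e (𝓜.wordEnd x u) ∂μ := by
  have last : -(n : ℤ) + (n + 1 : ℕ) = 1 := by push_cast; ring
  set φ : (Fin (n + 2) → E) → ℝ := fun u => g (u (Fin.last _)) (𝓜.wordEnd x (Fin.init u)) with hφ
  have approx_eq (σ : ℤ → E) :
      g (σ 1) (𝓜.codingApprox x σ n) = φ (window (-(n : ℤ)) (n + 2) σ) := by
    simp only [hφ, window_succ_eq_snoc (-(n : ℤ)) (n + 1) σ, Fin.snoc_last, Fin.init_snoc,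
      codingApprox_eq_wordEnd, last]
  simp only [approx_eq, hM.integral_window]
  simp only [hφ, sum_word_succ_snoc, wordProb_snoc, Fin.snoc_last, Fin.init_snoc, Finset.mul_sum,
    mul_assoc]

variable [PseudoMetricSpace K] [BorelSpace K]

theorem abs_integral_comp_codingApprox_sub_le (hM : 𝓜.IsMarkovMeasure μ M)
    (h_inv : 𝓜.adjointOp μ = μ) (h_contr : 𝓜.IsContractive a) (hx : ∀ v, x v ∈ 𝓜.vertexSet v)
    {C : ℝ} (hC : ∀ e y, |g e y| ≤ C) {L : NNReal} (hL : ∀ e, LipschitzWith L (g e)) (n : ℕ) :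
    |∫ σ, g (σ 1) (𝓜.codingApprox x σ n) ∂M - ∫ y, ∑ e, 𝓜.p e y * g e y ∂μ| ≤
      L * (a ^ (n + 1) * ∫ y, 𝓜.cellDist x y ∂μ) := by
  have sum_meas {b h : K → K} (hb : Measurable b) (hh : Measurable h) :
      Measurable fun y => ∑ e, 𝓜.p e (b y) * g e (h y) :=
    Finset.measurable_sum _ fun e _ => ((𝓜.p_measurable e).comp hb).mul
      ((hL e).continuous.measurable.comp hh)
  have word_int {h : (Fin (n + 1) → E) → K → K} (hh : ∀ u, Measurable (h u)) :
      Integrable (fun y => ∑ u, 𝓜.wordProb u y *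
        ∑ e, 𝓜.p e (𝓜.wordMap u y) * g e (h u y)) μ :=
    integrable_finsetSum _ fun u _ => (Integrable.of_bound
      (sum_meas (𝓜.measurable_wordMap u) (hh u)).aestronglyMeasurable C
      (ae_of_all _ fun y => 𝓜.abs_sum_p_mul_le (hC · _) _)).bdd_mul
      (𝓜.measurable_wordProb u).aestronglyMeasurable (ae_of_all _ (𝓜.abs_wordProb_le u))
  have approx_int := word_int (h := fun u _ => 𝓜.wordEnd x u) fun _ => measurable_const
  have mean_meas : Measurable fun y => ∑ e, 𝓜.p e y * g e y := sum_meas measurable_id measurable_id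
  rw [hM.integral_comp_codingApprox, ← integral_sum_wordProb h_inv (n + 1) mean_meas
    fun y => 𝓜.abs_sum_p_mul_le (hC · y) y,
    ← integral_sub approx_int (word_int 𝓜.measurable_wordMap), ← integral_const_mul,
    ← integral_const_mul, ← Real.norm_eq_abs]
  refine norm_integral_le_of_norm_le
    (((integrable_cellDist h_contr hx h_inv).const_mul _).const_mul _) (ae_of_all _ fun y => ?_)
  simpa only [← Finset.sum_sub_distrib, ← mul_sub, Real.norm_eq_abs] using
    abs_sum_wordProb_mul_sub_le h_contr hx hL n y

theorem integral_comp_codingMap_of_lipschitz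
    (h_open : ∀ v, IsOpen (𝓜.vertexSet v)) (hM : 𝓜.IsMarkovMeasure μ M)
    (hM_core : ∀ᵐ σ ∂M, σ ∈ 𝓜.codingCore x) (h_inv : 𝓜.adjointOp μ = μ)
    (h_contr : 𝓜.IsContractive a) (hx : ∀ v, x v ∈ 𝓜.vertexSet v) {C : ℝ}
    (hC : ∀ e y, |g e y| ≤ C) {L : NNReal} (hL : ∀ e, LipschitzWith L (g e)) :
    ∫ σ, g (σ 1) (𝓜.codingMap x σ) ∂M = ∫ y, ∑ e, 𝓜.p e y * g e y ∂μ := by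
  refine tendsto_nhds_unique (tendsto_integral_codingApprox h_open hx hM_core
    (fun e => (hL e).continuous.measurable) (fun e => (hL e).continuous.continuousOn)
    fun e y _ => hC e y) ?_
  refine tendsto_iff_dist_tendsto_zero.2 (squeeze_zero (fun _ => dist_nonneg)
    (hM.abs_integral_comp_codingApprox_sub_le h_inv h_contr hx hC hL) ?_)
  have pow_tendsto : Tendsto (fun n : ℕ => a ^ (n + 1)) atTop (𝓝 0) :=
    (tendsto_add_atTop_iff_nat 1).2
      (tendsto_pow_atTop_nhds_zero_of_lt_one h_contr.1.le h_contr.2.1)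
  simpa using (pow_tendsto.mul_const (∫ y, 𝓜.cellDist x y ∂μ)).const_mul (L : ℝ)

theorem map_codingMap_restrict (h_open : ∀ v, IsOpen (𝓜.vertexSet v))
    (hM : 𝓜.IsMarkovMeasure μ M) (hM_core : ∀ᵐ σ ∂M, σ ∈ 𝓜.codingCore x)
    (h_inv : 𝓜.adjointOp μ = μ) (h_contr : 𝓜.IsContractive a)
    (hx : ∀ v, x v ∈ 𝓜.vertexSet v) (e : E) :
    (M.restrict ((· 1) ⁻¹' {e})).map (𝓜.codingMap x) =
      μ.withDensity fun y => ENNReal.ofReal (𝓜.p e y) := by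
  have density_finite : IsFiniteMeasure (μ.withDensity fun y => ENNReal.ofReal (𝓜.p e y)) :=
    isFiniteMeasure_withDensity_ofReal (integrable_p e).2
  have edge_meas : MeasurableSet ((· 1) ⁻¹' {e} : Set (ℤ → E)) :=
    measurable_pi_apply 1 (measurableSet_singleton e)
  classical
  refine ext_of_forall_lipschitz_integral_eq fun f hf ⟨L, hL⟩ => ?_
  set g : E → K → ℝ := Pi.single e f
  have g_le (e' : E) (y : K) : |g e' y| ≤ 1 := by
    by_cases h : e' = e
    · subst h; simpa [g] using hf y
    · simp [g, h]
  have g_lipschitz (e' : E) : LipschitzWith L (g e') := by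
    by_cases h : e' = e
    · subst h; simpa [g] using hL
    · have g_eq : g e' = 0 := by simp [g, h]
      exact g_eq ▸ LipschitzWith.const' (0 : ℝ)
  have sum_eq (y : K) : ∑ e', 𝓜.p e' y * g e' y = 𝓜.p e y * f y := by
    rw [Finset.sum_eq_single e (by simp +contextual [g]) (by simp)]
    simp [g]
  rw [integral_map (aemeasurable_codingMap hM_core).restrict hL.continuous.aestronglyMeasurable,
    integral_withDensity_eq_integral_toReal_smul (𝓜.p_measurable e).ennreal_ofReal
      (ae_of_all _ fun _ => ENNReal.ofReal_lt_top), ← integral_indicator edge_meas]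
  simp only [ENNReal.toReal_ofReal (𝓜.p_nonneg e _), smul_eq_mul, ← sum_eq]
  rw [← hM.integral_comp_codingMap_of_lipschitz h_open hM_core h_inv h_contr hx g_le g_lipschitz]
  refine integral_congr_ae (ae_of_all _ fun σ => ?_)
  by_cases h : σ 1 = e
  · simp [g, h]
  · simp [g, h]

theorem integral_comp_codingMap (h_open : ∀ v, IsOpen (𝓜.vertexSet v))
    (hM : 𝓜.IsMarkovMeasure μ M) (hM_core : ∀ᵐ σ ∂M, σ ∈ 𝓜.codingCore x)
    (h_inv : 𝓜.adjointOp μ = μ) (h_contr : 𝓜.IsContractive a)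
    (hx : ∀ v, x v ∈ 𝓜.vertexSet v) (hg : ∀ e, Measurable (g e))
    (hg_int : Integrable (fun σ => g (σ 1) (𝓜.codingMap x σ)) M) :
    ∫ σ, g (σ 1) (𝓜.codingMap x σ) ∂M = ∑ e, ∫ y, 𝓜.p e y * g e y ∂μ := by
  have edge_meas (e : E) : MeasurableSet ((· 1) ⁻¹' {e} : Set (ℤ → E)) :=
    measurable_pi_apply 1 (measurableSet_singleton e)
  have edges_disjoint : Pairwise (Function.onFun Disjoint
      fun e : E => ((· 1) ⁻¹' {e} : Set (ℤ → E))) := pairwise_disjoint_fiber _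
  have edges_cover : ⋃ e : E, ((· 1) ⁻¹' {e} : Set (ℤ → E)) = univ := by
    ext; simp
  rw [← setIntegral_univ, ← edges_cover, integral_iUnion_fintype edge_meas edges_disjoint
    fun e => hg_int.integrableOn]
  refine Finset.sum_congr rfl fun e _ => ?_
  calc ∫ σ in (· 1) ⁻¹' {e}, g (σ 1) (𝓜.codingMap x σ) ∂M
      = ∫ σ in (· 1) ⁻¹' {e}, g e (𝓜.codingMap x σ) ∂M :=
        setIntegral_congr_fun (edge_meas e) fun σ hσ => by rw [show σ 1 = e from hσ]
    _ = ∫ y, g e y ∂((M.restrict ((· 1) ⁻¹' {e})).map (𝓜.codingMap x)) :=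
        (integral_map (aemeasurable_codingMap hM_core).restrict
          (hg e).aestronglyMeasurable).symm
    _ = ∫ y, 𝓜.p e y * g e y ∂μ := by
        rw [hM.map_codingMap_restrict h_open hM_core h_inv h_contr hx,
          integral_withDensity_eq_integral_toReal_smul (𝓜.p_measurable e).ennreal_ofReal
            (ae_of_all _ fun _ => ENNReal.ofReal_lt_top)]
        simp only [ENNReal.toReal_ofReal (𝓜.p_nonneg e _), smul_eq_mul]

end IsMarkovMeasure

end MarkovSystem

/-! ### Energy and pressure -/

theorem abs_neg_log_le {c s : ℝ} (hc : 0 < c) (hcs : c ≤ s) (hs : s ≤ 1) :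
    |-Real.log s| ≤ -Real.log c := by
  rw [abs_neg, abs_of_nonpos (Real.log_nonpos (hc.trans_le hcs).le hs)]
  exact neg_le_neg (Real.log_le_log hc hcs)

namespace MarkovSystem

theorem toENNReal_neg_energy {V E K : Type*} [Fintype E] [TopologicalSpace K] [MeasurableSpace K]
    {𝓜 : MarkovSystem V E K} {x : V → K} {σ : ℤ → E} (hσ : σ ∈ 𝓜.codingCore x)
    (hp : 0 < 𝓜.p (σ 1) (𝓜.codingMap x σ)) :
    (-(𝓜.energy x σ)).toENNReal = ENNReal.ofReal (-Real.log (𝓜.p (σ 1) (𝓜.codingMap x σ))) := by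
  rw [energy, if_pos hσ, ENNReal.log_ofReal_of_pos hp, ← EReal.coe_neg,
    EReal.toENNReal_of_ne_top (EReal.coe_ne_top _), EReal.toReal_coe]

section Energy

variable {V E K : Type*} [Fintype E] [MeasurableSpace E] [DiscreteMeasurableSpace E]
  [PseudoMetricSpace K] [MeasurableSpace K] [BorelSpace K] {𝓜 : MarkovSystem V E K}
  {ν : Measure (ℤ → E)} {x : V → K}

theorem ae_mem_codingCore_of_energyIntegral_ne_bot [CompleteSpace K] [SecondCountableTopology K]
    (h : energyIntegral ν (𝓜.energy x) ≠ ⊥) : ∀ᵐ σ ∂ν, σ ∈ 𝓜.codingCore x := by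
  by_contra core_not_ae
  refine h ?_
  have lintegral_eq_top : ∫⁻ σ, (-(𝓜.energy x σ)).toENNReal ∂ν = ⊤ := by
    refine top_unique ?_
    calc (⊤ : ENNReal) = ∫⁻ σ, (𝓜.codingCore x)ᶜ.indicator (fun _ => ⊤) σ ∂ν := by
          rw [lintegral_indicator_const (𝓜.measurableSet_codingCore x).compl]
          exact (ENNReal.top_mul core_not_ae).symm
      _ ≤ ∫⁻ σ, (-(𝓜.energy x σ)).toENNReal ∂ν := by
          refine lintegral_mono fun σ => ?_
          by_cases hσ : σ ∈ 𝓜.codingCore x <;> simp [energy, hσ]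
  rw [energyIntegral, lintegral_eq_top]
  rfl

theorem integrable_neg_log_comp_codingMap [IsFiniteMeasure ν]
    (h_open : ∀ v, IsOpen (𝓜.vertexSet v)) (hx : ∀ v, x v ∈ 𝓜.vertexSet v)
    (hν : ∀ᵐ σ ∂ν, σ ∈ 𝓜.codingCore x) {q : E → K → ℝ} (hq : ∀ e, Measurable (q e))
    (hq_le : ∀ e y, q e y ≤ 1) {c : ℝ} (hc : 0 < c)
    (hq_ge : ∀ e, ∀ y ∈ 𝓜.vertexSet (𝓜.ini e), c ≤ q e y) :
    Integrable (fun σ => -Real.log (q (σ 1) (𝓜.codingMap x σ))) ν := by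
  refine Integrable.of_bound
    (aemeasurable_comp_codingMap hν fun e => (hq e).log.neg).aestronglyMeasurable (-Real.log c) ?_
  filter_upwards [hν] with σ hσ
  exact abs_neg_log_le hc (hq_ge _ _ (𝓜.codingMap_mem h_open hx
    (𝓜.codingCore_subset_codingDomain hσ))) (hq_le _ _)

theorem energyIntegral_energy [IsFiniteMeasure ν] (h_open : ∀ v, IsOpen (𝓜.vertexSet v))
    (hx : ∀ v, x v ∈ 𝓜.vertexSet v) (hν : ∀ᵐ σ ∂ν, σ ∈ 𝓜.codingCore x) {δ : ℝ} (hδ : 0 < δ)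
    (h_pos : ∀ e, ∀ y ∈ 𝓜.vertexSet (𝓜.ini e), δ ≤ 𝓜.p e y) :
    energyIntegral ν (𝓜.energy x) =
      ((-∫ σ, -Real.log (𝓜.p (σ 1) (𝓜.codingMap x σ)) ∂ν : ℝ) : EReal) := by
  have loss_nonneg (σ : ℤ → E) : 0 ≤ -Real.log (𝓜.p (σ 1) (𝓜.codingMap x σ)) :=
    neg_nonneg.2 (Real.log_nonpos (𝓜.p_nonneg _ _) (𝓜.p_le_one _ _))
  have lintegral_eq : ∫⁻ σ, (-(𝓜.energy x σ)).toENNReal ∂ν =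
      ENNReal.ofReal (∫ σ, -Real.log (𝓜.p (σ 1) (𝓜.codingMap x σ)) ∂ν) := by
    rw [ofReal_integral_eq_lintegral_ofReal (integrable_neg_log_comp_codingMap h_open hx hν
      𝓜.p_measurable 𝓜.p_le_one hδ h_pos) (ae_of_all _ loss_nonneg)]
    refine lintegral_congr_ae ?_
    filter_upwards [hν] with σ hσ
    exact toENNReal_neg_energy hσ (hδ.trans_le (h_pos _ _ (𝓜.codingMap_mem h_open hx
      (𝓜.codingCore_subset_codingDomain hσ))))
  rw [energyIntegral, lintegral_eq, EReal.coe_ennreal_ofReal,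
    max_eq_left (integral_nonneg loss_nonneg), EReal.coe_neg]

end Energy

theorem IsMarkovMeasure.integral_neg_log_p_codingMap {V E K : Type*} [Fintype E]
    [MeasurableSpace E] [DiscreteMeasurableSpace E] [PseudoMetricSpace K] [MeasurableSpace K]
    [BorelSpace K] {𝓜 : MarkovSystem V E K} {μ : Measure K} [IsProbabilityMeasure μ]
    {M : Measure (ℤ → E)} [IsFiniteMeasure M] {a δ : ℝ} {x : V → K}
    (h_open : ∀ v, IsOpen (𝓜.vertexSet v)) (hM : 𝓜.IsMarkovMeasure μ M)
    (hM_core : ∀ᵐ σ ∂M, σ ∈ 𝓜.codingCore x) (h_inv : 𝓜.adjointOp μ = μ)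
    (h_contr : 𝓜.IsContractive a) (hx : ∀ v, x v ∈ 𝓜.vertexSet v) (hδ : 0 < δ)
    (h_pos : ∀ e, ∀ y ∈ 𝓜.vertexSet (𝓜.ini e), δ ≤ 𝓜.p e y) :
    ∫ σ, -Real.log (𝓜.p (σ 1) (𝓜.codingMap x σ)) ∂M = ∫ y, 𝓜.stepEntropy y ∂μ := by
  rw [hM.integral_comp_codingMap (g := fun e y => -Real.log (𝓜.p e y)) h_open hM_core h_inv
    h_contr hx (fun e => (𝓜.p_measurable e).log.neg)
    (integrable_neg_log_comp_codingMap h_open hx hM_core 𝓜.p_measurable 𝓜.p_le_one hδ h_pos)]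
  have stepEntropy_eq : ∫ y, 𝓜.stepEntropy y ∂μ = ∑ e, ∫ y, Real.negMulLog (𝓜.p e y) ∂μ :=
    integral_finsetSum _ fun e _ => Integrable.of_bound (Real.continuous_negMulLog.measurable.comp
      (𝓜.p_measurable e)).aestronglyMeasurable 1
      (ae_of_all _ fun y => abs_negMulLog_le_one (𝓜.p_nonneg e y) (𝓜.p_le_one e y))
  rw [stepEntropy_eq]
  simp only [Real.negMulLog, neg_mul, mul_neg]

theorem IsMarkovMeasure.integral_stepEntropy_le_ksEntropy {V E K : Type*} [Fintype E]
    [MeasurableSpace E] [DiscreteMeasurableSpace E] [MeasurableSpace K] {𝓜 : MarkovSystem V E K}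
    {μ : Measure K} [IsProbabilityMeasure μ] {M : Measure (ℤ → E)} (hM : 𝓜.IsMarkovMeasure μ M)
    (h_inv : 𝓜.adjointOp μ = μ) :
    ((∫ y, 𝓜.stepEntropy y ∂μ : ℝ) : EReal) ≤ ksEntropy (codeShift E) M := by
  set φ := Fintype.equivFin E
  have φ_meas : Measurable fun σ : ℤ → E => φ (σ 0) :=
    (measurable_of_finite φ).comp (measurable_pi_apply (0 : ℤ))
  refine le_trans ?_ (le_iSup₂_of_le (Fintype.card E) (fun σ : ℤ → E => φ (σ 0))
    (le_iSup_of_le φ_meas le_rfl))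
  refine le_limsup_of_frequently_le (Eventually.frequently ?_) (by isBoundedDefault)
  filter_upwards [eventually_gt_atTop 0] with n hn
  rw [EReal.coe_le_coe_iff, le_div_iff₀ (by exact_mod_cast hn), mul_comm]
  refine (𝓜.le_sum_negMulLog_blockProb h_inv n).trans_eq ?_
  rw [partitionEntropy, ← (Equiv.arrowCongr (Equiv.refl (Fin n)) φ).sum_comp]
  refine Finset.sum_congr rfl fun u _ => ?_
  rw [← hM 0 n u]
  congr 2
  ext σ
  simp only [mem_preimage, mem_singleton_iff, funext_iff, itinerary, codeShift_iterate, window,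
    Equiv.arrowCongr_apply, Equiv.coe_refl, Equiv.refl_symm, Function.comp_apply, id_eq,
    φ.apply_eq_iff_eq]

theorem pressure_energy_nonneg {V E K : Type*} [Fintype E] [MeasurableSpace E]
    [DiscreteMeasurableSpace E] [PseudoMetricSpace K] [CompleteSpace K]
    [SecondCountableTopology K] [MeasurableSpace K] [BorelSpace K] {𝓜 : MarkovSystem V E K}
    {μ : Measure K} [IsProbabilityMeasure μ] {a δ : ℝ} {x : V → K}
    (h_open : ∀ v, IsOpen (𝓜.vertexSet v)) (h_inv : 𝓜.adjointOp μ = μ)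
    (h_contr : 𝓜.IsContractive a) (hx : ∀ v, x v ∈ 𝓜.vertexSet v) (hδ : 0 < δ)
    (h_pos : ∀ e, ∀ y ∈ 𝓜.vertexSet (𝓜.ini e), δ ≤ 𝓜.p e y) :
    0 ≤ pressure (codeShift E) (𝓜.energy x) := by
  obtain ⟨M, hM_inv, hM⟩ := exists_isMarkovMeasure h_inv
  have := hM_inv.1
  have hM_core := hM.ae_mem_codingCore hM_inv h_inv h_contr hx
  refine le_trans ?_ (le_iSup₂_of_le M hM_inv
    (add_le_add_left (hM.integral_stepEntropy_le_ksEntropy h_inv) _))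
  rw [energyIntegral_energy h_open hx hM_core hδ h_pos,
    hM.integral_neg_log_p_codingMap h_open hM_core h_inv h_contr hx hδ h_pos, ← EReal.coe_add,
    add_neg_cancel, EReal.coe_zero]

end MarkovSystem

/-! ### Optimality of the transition probabilities -/

theorem integral_eq_zero_of_eventually_integral_log_nonpos {Ω : Type*} [MeasurableSpace Ω]
    {μ : Measure Ω} [IsFiniteMeasure μ] {θ : Ω → ℝ} (hθ : AEMeasurable θ μ) {B : ℝ}
    (hB : ∀ᵐ ω ∂μ, |θ ω| ≤ B) (h : ∀ᶠ t : ℝ in 𝓝 0, ∫ ω, Real.log (1 + t * θ ω) ∂μ ≤ 0) :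
    ∫ ω, θ ω ∂μ = 0 := by
  have small : ∀ᶠ t : ℝ in 𝓝 0, |t| * B < 1 / 2 := by
    have cont : Continuous fun t : ℝ => |t| * B := by fun_prop
    exact cont.continuousAt.eventually_lt_const (by norm_num)
  have half_le {t s : ℝ} (ht : |t| * B < 1 / 2) (hs : |s| ≤ B) : 1 / 2 ≤ 1 + t * s := by
    have mul_abs_le : |t * s| ≤ |t| * B := by
      rw [abs_mul]; exact mul_le_mul_of_nonneg_left hs (abs_nonneg t)
    linarith [neg_abs_le (t * s)]
  have deriv_at_zero : HasDerivAt (fun t => ∫ ω, Real.log (1 + t * θ ω) ∂μ) (∫ ω, θ ω ∂μ) 0 := by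
    have := (hasDerivAt_integral_of_dominated_loc_of_deriv_le (μ := μ) (x₀ := (0 : ℝ))
      (F := fun t ω => Real.log (1 + t * θ ω)) (F' := fun t ω => θ ω / (1 + t * θ ω))
      (bound := fun _ => 2 * B) small (.of_forall fun t =>
        ((hθ.const_mul t).const_add 1).log.aestronglyMeasurable) (by simp)
      (hθ.div ((hθ.const_mul 0).const_add 1)).aestronglyMeasurable ?_ (integrable_const _) ?_).2
    · simpa using this
    · filter_upwards [hB] with ω hω t ht
      have := half_le ht hω
      rw [Real.norm_eq_abs, abs_div, abs_of_pos (by linarith : 0 < 1 + t * θ ω),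
        div_le_iff₀ (by linarith)]
      nlinarith [abs_nonneg (θ ω)]
    · filter_upwards [hB] with ω hω t ht
      simpa using (((hasDerivAt_id t).mul_const (θ ω)).const_add 1).log
        (by have := half_le ht hω; simp only [id]; linarith)
  have isLocalMax : IsLocalMax (fun t => ∫ ω, Real.log (1 + t * θ ω) ∂μ) 0 := by
    simpa [IsLocalMax, IsMaxFilter] using h
  exact isLocalMax.hasDerivAt_eq_zero deriv_at_zero

namespace MarkovSystem

section Gibbs

variable {V E K : Type*} [Fintype E] [MeasurableSpace E] [DiscreteMeasurableSpace E]
  [PseudoMetricSpace K] [MeasurableSpace K] {𝓜 : MarkovSystem V E K} {Λ : Measure (ℤ → E)}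
  {x : V → K} {q : E → K → ℝ} {c δ : ℝ}

theorem ksEntropy_codeShift_le_integral_neg_log (h_open : ∀ v, IsOpen (𝓜.vertexSet v))
    (hx : ∀ v, x v ∈ 𝓜.vertexSet v) (hΛ : Λ ∈ invariantProb (codeShift E))
    (hΛ_core : ∀ᵐ σ ∂Λ, σ ∈ 𝓜.codingCore x) (hq : ∀ e, Measurable (q e))
    (hq_cont : ∀ e, ContinuousOn (q e) (𝓜.vertexSet (𝓜.ini e))) (hq_nonneg : ∀ e y, 0 ≤ q e y)
    (hq_sum : ∀ y, ∑ e, q e y ≤ 1) (hc : 0 < c)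
    (hq_ge : ∀ e, ∀ y ∈ 𝓜.vertexSet (𝓜.ini e), c ≤ q e y) :
    ksEntropy (codeShift E) Λ ≤ ((∫ σ, -Real.log (q (σ 1) (𝓜.codingMap x σ)) ∂Λ : ℝ) : EReal) := by
  have := hΛ.1
  have q_le_one (e : E) (y : K) : q e y ≤ 1 :=
    (Finset.single_le_sum (fun e _ => hq_nonneg e y) (Finset.mem_univ e)).trans (hq_sum y)
  have loss_tendsto := tendsto_integral_codingApprox (g := fun e y => -Real.log (q e y)) h_open hx
    hΛ_core (fun e => (hq e).log.neg)
    (fun e => ((hq_cont e).log fun y hy => (hc.trans_le (hq_ge e y hy)).ne').neg)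
    (fun e y hy => abs_neg_log_le hc (hq_ge e y hy) (q_le_one e y))
  refine ge_of_tendsto' ((continuous_coe_real_ereal.tendsto _).comp loss_tendsto) fun n => ?_
  refine ksEntropy_codeShift_le (q := fun σ e => q e (𝓜.codingApprox x σ n)) (n := n) hΛ
    ⟨fun σ τ h => ?_, fun σ e => hq_nonneg _ _, fun σ => hq_sum _⟩ ?_
  · simp only [codingApprox_eq_wordEnd, h]
  · filter_upwards [hΛ_core] with σ hσ
    exact hc.trans_le (hq_ge _ _
      (𝓜.codingApprox_mem hx (𝓜.codingCore_subset_codingDomain hσ).1 n))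

theorem integral_neg_log_p_le [BorelSpace K] (h_open : ∀ v, IsOpen (𝓜.vertexSet v))
    (hδ : 0 < δ) (h_pos : ∀ e, ∀ y ∈ 𝓜.vertexSet (𝓜.ini e), δ ≤ 𝓜.p e y)
    (hx : ∀ v, x v ∈ 𝓜.vertexSet v) (hΛ : Λ ∈ invariantProb (codeShift E))
    (hΛ_core : ∀ᵐ σ ∂Λ, σ ∈ 𝓜.codingCore x)
    (hΛ_free : 0 ≤ ksEntropy (codeShift E) Λ + energyIntegral Λ (𝓜.energy x))
    (hq : ∀ e, Measurable (q e)) (hq_cont : ∀ e, ContinuousOn (q e) (𝓜.vertexSet (𝓜.ini e)))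
    (hq_nonneg : ∀ e y, 0 ≤ q e y) (hq_sum : ∀ y, ∑ e, q e y ≤ 1) (hc : 0 < c)
    (hq_ge : ∀ e, ∀ y ∈ 𝓜.vertexSet (𝓜.ini e), c ≤ q e y) :
    ∫ σ, -Real.log (𝓜.p (σ 1) (𝓜.codingMap x σ)) ∂Λ ≤
      ∫ σ, -Real.log (q (σ 1) (𝓜.codingMap x σ)) ∂Λ := by
  have := hΛ.1
  have free_le := hΛ_free.trans (add_le_add_left (ksEntropy_codeShift_le_integral_neg_log h_open hx
    hΛ hΛ_core hq hq_cont hq_nonneg hq_sum hc hq_ge) _)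
  rw [energyIntegral_energy h_open hx hΛ_core hδ h_pos, ← EReal.coe_add, ← EReal.coe_zero,
    EReal.coe_le_coe_iff] at free_le
  linarith

end Gibbs

/-! ### Increments and invariance -/

section Increment

variable {V E K : Type*} [Fintype E] [MeasurableSpace K] (𝓜 : MarkovSystem V E K)

/-- The increment of `f` along the edge `e`, centred by its conditional mean. -/
noncomputable def increment (f : K → ℝ) (e : E) (y : K) : ℝ := f (𝓜.w e y) - 𝓜.markovOp f y

/-- The transition probabilities tilted by `t` times the increments of `f`, a competitor to `p`
whose total mass is one because the increments have conditional mean zero. -/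
noncomputable def tilt (f : K → ℝ) (t : ℝ) (e : E) (y : K) : ℝ :=
  𝓜.p e y * (1 + t * 𝓜.increment f e y)

variable {f : K → ℝ} {C t : ℝ}

theorem sum_p_mul_increment (f : K → ℝ) (y : K) : ∑ e, 𝓜.p e y * 𝓜.increment f e y = 0 := by
  simp only [increment, mul_sub, Finset.sum_sub_distrib, ← Finset.sum_mul, 𝓜.p_sum, one_mul]
  exact sub_self _

theorem sum_tilt (f : K → ℝ) (t : ℝ) (y : K) : ∑ e, 𝓜.tilt f t e y = 1 := by
  simp only [tilt, mul_add, mul_one, mul_left_comm _ t, Finset.sum_add_distrib, ← Finset.mul_sum,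
    𝓜.sum_p_mul_increment, 𝓜.p_sum, mul_zero, add_zero]

theorem measurable_increment (hf : Measurable f) (e : E) : Measurable (𝓜.increment f e) :=
  (hf.comp (𝓜.w_measurable e)).sub (𝓜.measurable_markovOp hf)

theorem measurable_tilt (hf : Measurable f) (t : ℝ) (e : E) : Measurable (𝓜.tilt f t e) :=
  (𝓜.p_measurable e).mul (((𝓜.measurable_increment hf e).const_mul t).const_add 1)

theorem abs_increment_le (hC : ∀ y, |f y| ≤ C) (e : E) (y : K) :
    |𝓜.increment f e y| ≤ 2 * C :=
  calc |𝓜.increment f e y| ≤ |f (𝓜.w e y)| + |𝓜.markovOp f y| := abs_sub _ _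
    _ ≤ C + C := add_le_add (hC _) (𝓜.abs_markovOp_le hC y)
    _ = 2 * C := (two_mul C).symm

theorem half_le_one_add_mul_increment (hC : ∀ y, |f y| ≤ C) (ht : |t| * (2 * C) ≤ 1 / 2) (e : E)
    (y : K) : 1 / 2 ≤ 1 + t * 𝓜.increment f e y := by
  have mul_abs_le : |t * 𝓜.increment f e y| ≤ 1 / 2 := by
    rw [abs_mul]
    exact (mul_le_mul_of_nonneg_left (𝓜.abs_increment_le hC e y) (abs_nonneg t)).trans ht
  linarith [neg_abs_le (t * 𝓜.increment f e y)]

theorem p_mul_half_le_tilt (hC : ∀ y, |f y| ≤ C) (ht : |t| * (2 * C) ≤ 1 / 2) (e : E) (y : K) :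
    𝓜.p e y * (1 / 2) ≤ 𝓜.tilt f t e y :=
  mul_le_mul_of_nonneg_left (𝓜.half_le_one_add_mul_increment hC ht e y) (𝓜.p_nonneg e y)

theorem tilt_nonneg (hC : ∀ y, |f y| ≤ C) (ht : |t| * (2 * C) ≤ 1 / 2) (e : E) (y : K) :
    0 ≤ 𝓜.tilt f t e y :=
  (mul_nonneg (𝓜.p_nonneg e y) one_half_pos.le).trans (𝓜.p_mul_half_le_tilt hC ht e y)

theorem tilt_le_one (hC : ∀ y, |f y| ≤ C) (ht : |t| * (2 * C) ≤ 1 / 2) (e : E) (y : K) :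
    𝓜.tilt f t e y ≤ 1 :=
  (Finset.single_le_sum (fun e _ => 𝓜.tilt_nonneg hC ht e y) (Finset.mem_univ e)).trans_eq
    (𝓜.sum_tilt f t y)

theorem continuousOn_tilt [TopologicalSpace K] (h_open : ∀ v, IsOpen (𝓜.vertexSet v))
    (hw : ∀ e, ContinuousOn (𝓜.w e) (𝓜.vertexSet (𝓜.ini e)))
    (hp : ∀ e, ContinuousOn (𝓜.p e) (𝓜.vertexSet (𝓜.ini e))) (hf : Continuous f) (t : ℝ) (e : E) :
    ContinuousOn (𝓜.tilt f t e) (𝓜.vertexSet (𝓜.ini e)) := by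
  have increment_cont : ContinuousOn (𝓜.increment f e) (𝓜.vertexSet (𝓜.ini e)) :=
    (hf.comp_continuousOn (hw e)).sub (𝓜.continuous_markovOp h_open hw hp hf).continuousOn
  exact (hp e).mul (continuousOn_const.add (continuousOn_const.mul increment_cont))

end Increment

section Invariance

variable {V E K : Type*} [Fintype E] [MeasurableSpace E] [DiscreteMeasurableSpace E]
  [MeasurableSpace K] {𝓜 : MarkovSystem V E K} {Λ : Measure (ℤ → E)} {x : V → K} {f : K → ℝ}
  {C δ : ℝ}

theorem integral_log_one_add_mul_increment_nonpos [PseudoMetricSpace K] [BorelSpace K]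
    (h_open : ∀ v, IsOpen (𝓜.vertexSet v))
    (hw : ∀ e, ContinuousOn (𝓜.w e) (𝓜.vertexSet (𝓜.ini e)))
    (hp : ∀ e, ContinuousOn (𝓜.p e) (𝓜.vertexSet (𝓜.ini e))) (hδ : 0 < δ)
    (h_pos : ∀ e, ∀ y ∈ 𝓜.vertexSet (𝓜.ini e), δ ≤ 𝓜.p e y) (hx : ∀ v, x v ∈ 𝓜.vertexSet v)
    (hΛ : Λ ∈ invariantProb (codeShift E)) (hΛ_core : ∀ᵐ σ ∂Λ, σ ∈ 𝓜.codingCore x)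
    (hΛ_free : 0 ≤ ksEntropy (codeShift E) Λ + energyIntegral Λ (𝓜.energy x))
    (hf : Continuous f) (hC : ∀ y, |f y| ≤ C) {t : ℝ} (ht : |t| * (2 * C) ≤ 1 / 2) :
    ∫ σ, Real.log (1 + t * 𝓜.increment f (σ 1) (𝓜.codingMap x σ)) ∂Λ ≤ 0 := by
  have := hΛ.1
  have tilt_ge (e : E) (y : K) (hy : y ∈ 𝓜.vertexSet (𝓜.ini e)) : δ * (1 / 2) ≤ 𝓜.tilt f t e y :=
    (mul_le_mul_of_nonneg_right (h_pos e y hy) one_half_pos.le).trans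
      (𝓜.p_mul_half_le_tilt hC ht e y)
  have tilt_meas := 𝓜.measurable_tilt hf.measurable t
  have p_optimal := integral_neg_log_p_le h_open hδ h_pos hx hΛ hΛ_core hΛ_free tilt_meas
    (𝓜.continuousOn_tilt h_open hw hp hf t) (𝓜.tilt_nonneg hC ht) (fun y => (𝓜.sum_tilt f t y).le)
    (mul_pos hδ one_half_pos) tilt_ge
  have log_eq : ∀ᵐ σ ∂Λ, Real.log (1 + t * 𝓜.increment f (σ 1) (𝓜.codingMap x σ)) =
      -Real.log (𝓜.p (σ 1) (𝓜.codingMap x σ)) - -Real.log (𝓜.tilt f t (σ 1) (𝓜.codingMap x σ)) := by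
    filter_upwards [hΛ_core] with σ hσ
    have p_pos := hδ.trans_le (h_pos _ _ (𝓜.codingMap_mem h_open hx
      (𝓜.codingCore_subset_codingDomain hσ)))
    have factor_pos := one_half_pos.trans_le
      (𝓜.half_le_one_add_mul_increment hC ht (σ 1) (𝓜.codingMap x σ))
    rw [tilt, Real.log_mul p_pos.ne' factor_pos.ne']
    ring
  rw [integral_congr_ae log_eq, integral_sub
    (integrable_neg_log_comp_codingMap h_open hx hΛ_core 𝓜.p_measurable 𝓜.p_le_one hδ h_pos)
    (integrable_neg_log_comp_codingMap h_open hx hΛ_core tilt_meas (𝓜.tilt_le_one hC ht)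
      (mul_pos hδ one_half_pos) tilt_ge)]
  exact sub_nonpos.2 p_optimal

theorem integral_increment_codingMap_eq_zero [PseudoMetricSpace K] [BorelSpace K]
    (h_open : ∀ v, IsOpen (𝓜.vertexSet v))
    (hw : ∀ e, ContinuousOn (𝓜.w e) (𝓜.vertexSet (𝓜.ini e)))
    (hp : ∀ e, ContinuousOn (𝓜.p e) (𝓜.vertexSet (𝓜.ini e))) (hδ : 0 < δ)
    (h_pos : ∀ e, ∀ y ∈ 𝓜.vertexSet (𝓜.ini e), δ ≤ 𝓜.p e y) (hx : ∀ v, x v ∈ 𝓜.vertexSet v)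
    (hΛ : Λ ∈ invariantProb (codeShift E)) (hΛ_core : ∀ᵐ σ ∂Λ, σ ∈ 𝓜.codingCore x)
    (hΛ_free : 0 ≤ ksEntropy (codeShift E) Λ + energyIntegral Λ (𝓜.energy x))
    (hf : Continuous f) (hC : ∀ y, |f y| ≤ C) :
    ∫ σ, 𝓜.increment f (σ 1) (𝓜.codingMap x σ) ∂Λ = 0 := by
  have := hΛ.1
  have small : ∀ᶠ t : ℝ in 𝓝 0, |t| * (2 * C) < 1 / 2 := by
    have cont : Continuous fun t : ℝ => |t| * (2 * C) := by fun_prop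
    exact cont.continuousAt.eventually_lt_const (by norm_num)
  refine integral_eq_zero_of_eventually_integral_log_nonpos
    (aemeasurable_comp_codingMap hΛ_core (𝓜.measurable_increment hf.measurable))
    (ae_of_all _ fun σ => 𝓜.abs_increment_le hC _ _) ?_
  filter_upwards [small] with t ht
  exact integral_log_one_add_mul_increment_nonpos h_open hw hp hδ h_pos hx hΛ hΛ_core hΛ_free hf hC
    ht.le

theorem integral_increment_codingMap [MetricSpace K] [BorelSpace K]
    (h_open : ∀ v, IsOpen (𝓜.vertexSet v))
    (hw : ∀ e, ContinuousOn (𝓜.w e) (𝓜.vertexSet (𝓜.ini e))) (hx : ∀ v, x v ∈ 𝓜.vertexSet v)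
    (hΛ : Λ ∈ invariantProb (codeShift E)) (hΛ_core : ∀ᵐ σ ∂Λ, σ ∈ 𝓜.codingCore x)
    (hf : Measurable f) (hC : ∀ y, |f y| ≤ C) :
    ∫ σ, 𝓜.increment f (σ 1) (𝓜.codingMap x σ) ∂Λ =
      ∫ y, f y ∂Λ.map (𝓜.codingMap x) - ∫ y, 𝓜.markovOp f y ∂Λ.map (𝓜.codingMap x) := by
  obtain ⟨_, hS⟩ := hΛ
  have hF := aemeasurable_codingMap hΛ_core
  have hUf := 𝓜.measurable_markovOp hf
  have f_int : Integrable (fun σ => f (𝓜.codingMap x σ)) Λ :=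
    Integrable.of_bound (hf.comp_aemeasurable hF).aestronglyMeasurable C (ae_of_all _ fun _ => hC _)
  have Uf_int : Integrable (fun σ => 𝓜.markovOp f (𝓜.codingMap x σ)) Λ :=
    Integrable.of_bound (hUf.comp_aemeasurable hF).aestronglyMeasurable C
      (ae_of_all _ fun _ => 𝓜.abs_markovOp_le hC _)
  have shifted_int : Integrable (fun σ => f (𝓜.codingMap x (codeShift E σ))) Λ :=
    hS.integrable_comp_of_integrable f_int
  have shift_eq : ∫ σ, f (𝓜.codingMap x (codeShift E σ)) ∂Λ = ∫ σ, f (𝓜.codingMap x σ) ∂Λ := by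
    conv_rhs => rw [← hS.map_eq]
    rw [integral_map hS.aemeasurable (by rw [hS.map_eq]; exact f_int.aestronglyMeasurable)]
  rw [integral_map hF hf.aestronglyMeasurable, integral_map hF hUf.aestronglyMeasurable,
    ← shift_eq, ← integral_sub shifted_int Uf_int]
  refine integral_congr_ae ?_
  filter_upwards [hΛ_core] with σ hσ
  rw [increment, codingMap_codeShift 𝓜 h_open hw hx hσ]

end Invariance

theorem isFiniteMeasure_adjointOp {V E K : Type*} [Fintype E] [MeasurableSpace K]
    (𝓜 : MarkovSystem V E K) (ν : Measure K) [IsFiniteMeasure ν] :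
    IsFiniteMeasure (𝓜.adjointOp ν) := by
  have (e : E) : IsFiniteMeasure (ν.withDensity fun y => ENNReal.ofReal (𝓜.p e y)) :=
    isFiniteMeasure_withDensity_ofReal (integrable_p e).2
  rw [adjointOp]
  infer_instance

theorem adjointOp_map_codingMap {V E K : Type*} [Fintype E] [MeasurableSpace E]
    [DiscreteMeasurableSpace E] [MetricSpace K] [MeasurableSpace K] [BorelSpace K]
    {𝓜 : MarkovSystem V E K} {Λ : Measure (ℤ → E)} {x : V → K} {δ : ℝ}
    (h_open : ∀ v, IsOpen (𝓜.vertexSet v))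
    (hw : ∀ e, ContinuousOn (𝓜.w e) (𝓜.vertexSet (𝓜.ini e)))
    (hp : ∀ e, ContinuousOn (𝓜.p e) (𝓜.vertexSet (𝓜.ini e))) (hδ : 0 < δ)
    (h_pos : ∀ e, ∀ y ∈ 𝓜.vertexSet (𝓜.ini e), δ ≤ 𝓜.p e y) (hx : ∀ v, x v ∈ 𝓜.vertexSet v)
    (hΛ : Λ ∈ invariantProb (codeShift E)) (hΛ_core : ∀ᵐ σ ∂Λ, σ ∈ 𝓜.codingCore x)
    (hΛ_free : 0 ≤ ksEntropy (codeShift E) Λ + energyIntegral Λ (𝓜.energy x)) :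
    𝓜.adjointOp (Λ.map (𝓜.codingMap x)) = Λ.map (𝓜.codingMap x) := by
  have := hΛ.1
  have := Measure.isProbabilityMeasure_map (aemeasurable_codingMap hΛ_core)
  have := 𝓜.isFiniteMeasure_adjointOp (Λ.map (𝓜.codingMap x))
  refine ext_of_forall_integral_eq_of_IsFiniteMeasure fun f => ?_
  rw [𝓜.integral_adjointOp _ f f.continuous.measurable ‖f‖ f.norm_coe_le_norm, ← sub_eq_zero,
    ← neg_sub, neg_eq_zero, ← integral_increment_codingMap h_open hw hx hΛ hΛ_core
      f.continuous.measurable f.norm_coe_le_norm]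
  exact integral_increment_codingMap_eq_zero h_open hw hp hδ h_pos hx hΛ hΛ_core hΛ_free
    f.continuous f.norm_coe_le_norm

end MarkovSystem

theorem proposition2_general {V E K : Type*} [Fintype E] [MeasurableSpace E]
    [DiscreteMeasurableSpace E] [MetricSpace K] [CompleteSpace K] [SecondCountableTopology K]
    [MeasurableSpace K] [BorelSpace K] (𝓜 : MarkovSystem V E K) {a : ℝ}
    (h_contr : 𝓜.IsContractive a) (h_open : ∀ v, IsOpen (𝓜.vertexSet v))
    (h_cont : ∀ e, ContinuousOn (𝓜.p e) (𝓜.vertexSet (𝓜.ini e))) {δ : ℝ} (hδ : 0 < δ)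
    (h_pos : ∀ e, ∀ y ∈ 𝓜.vertexSet (𝓜.ini e), δ ≤ 𝓜.p e y) {μ : Measure K}
    [IsProbabilityMeasure μ] (h_inv : 𝓜.adjointOp μ = μ) {x : V → K}
    (hx : ∀ v, x v ∈ 𝓜.vertexSet v) {Λ : Measure (ℤ → E)}
    (hΛ : IsEquilibriumState (codeShift E) (𝓜.energy x) Λ) :
    (∀ᵐ σ ∂Λ, σ ∈ 𝓜.codingCore x) ∧ AEMeasurable (𝓜.codingMap x) Λ ∧
      𝓜.adjointOp (Λ.map (𝓜.codingMap x)) = Λ.map (𝓜.codingMap x) := by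
  obtain ⟨Λ_inv, free_eq_pressure⟩ := hΛ
  have free_nonneg : 0 ≤ ksEntropy (codeShift E) Λ + energyIntegral Λ (𝓜.energy x) :=
    (MarkovSystem.pressure_energy_nonneg h_open h_inv h_contr hx hδ h_pos).trans_eq
      free_eq_pressure.symm
  have core : ∀ᵐ σ ∂Λ, σ ∈ 𝓜.codingCore x := by
    refine MarkovSystem.ae_mem_codingCore_of_energyIntegral_ne_bot fun h => ?_
    rw [h, EReal.add_bot] at free_nonneg
    exact absurd free_nonneg (by simp)
  exact ⟨core, MarkovSystem.aemeasurable_codingMap core, MarkovSystem.adjointOp_map_codingMap h_open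
    (MarkovSystem.continuousOn_w h_contr hδ h_pos) h_cont hδ h_pos hx Λ_inv core free_nonneg⟩

theorem proposition2
    {V E K : Type*} [Fintype V] [Fintype E] [MeasurableSpace E] [DiscreteMeasurableSpace E]
    [MetricSpace K] [ProperSpace K] [MeasurableSpace K] [BorelSpace K]
    (𝓜 : MarkovSystem V E K) (a : ℝ) (h_contr : 𝓜.IsContractive a)
    (h_open : ∀ v, IsOpen (𝓜.vertexSet v))
    (h_unif : ∀ e, UniformContinuousOn (𝓜.p e) (𝓜.vertexSet (𝓜.ini e)))
    (δ : ℝ) (hδ : 0 < δ) (h_pos : ∀ e, ∀ y ∈ 𝓜.vertexSet (𝓜.ini e), δ ≤ 𝓜.p e y)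
    (h_surj : Function.Surjective 𝓜.ini)
    (μ : Measure K) (h_prob : IsProbabilityMeasure μ) (h_inv : 𝓜.adjointOp μ = μ)
    (x : V → K) (hx : ∀ v, x v ∈ 𝓜.vertexSet v)
    (Λ : Measure (ℤ → E)) (hΛ : IsEquilibriumState (codeShift E) (𝓜.energy x) Λ) :
    (∀ᵐ σ ∂Λ, σ ∈ 𝓜.codingCore x) ∧
    AEMeasurable (𝓜.codingMap x) Λ ∧
    𝓜.adjointOp (Λ.map (𝓜.codingMap x)) = Λ.map (𝓜.codingMap x) :=
  proposition2_general 𝓜 h_contr h_open (fun e => (h_unif e).continuousOn) hδ h_pos h_inv hx hΛ
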